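/- Let $B\subset\mathbb R^3$ be a bounded Borel set, $b>0$, let $\mathbb S^2$ be the unit hemisphere in $\mathbb R^3$, and $Y=B\times(0,b]\times\mathbb S^2$. A point $y=(z,r,\phi)\in Y$ represents the circular plate with centre $z$, radius $r$ and unit normal $\phi$, i.e. the set $\{w\in\mathbb R^3:\ |w-z|\le r,\ \langle\phi,w-z\rangle=0\}$, again denoted by $y$. Let $\lambda(d(z,r,\phi))=\rho(z)\,dz\,Q(dr)\,V(d\phi)$, where $\rho\ge 0$ is a bounded measurable function on $B$ and $Q$, $V$ are probability measures on $(0,b]$ and $\mathbb S^2$, and let $\eta$ be the Poisson process on $Y$ with (finite) intensity measure $\lambda$. Write $A(y)=\pi r^2$ for the area of a plate, $l(y_1\cap y_2)$ for the length of the intersection of two plates and, for a finite point configuration $x$ on $Y$, $$S(x)=\sum_{s\in x}A(s),\qquad L(x)=\frac12\sum_{(s,t)\in x^2_{\ne}}l(s\cap t),\qquad N(x)=\frac16\sum_{(s,t,u)\in x^3_{\ne}}1_{[s\cap t\cap u\ne\emptyset]},$$ where $x^k_{\ne}$ is the set of ordered $k$-tuples of different points of $x$; put $G=(S,L,N)$.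 For $\nu=(\nu_1,\nu_2,\nu_3)\in\mathbb R^3$ with $\nu_2\le 0$ and $\nu_3\le 0$ let $\mu$ be the point process whose distribution has density $p(x)=c_\nu^{-1}\exp(\nu\cdot G(x))$ with respect to the distribution of $\eta$, where $c_\nu=\mathbb E\exp(\nu\cdot G(\eta))$ is the normalizing constant. With the difference operators $D_yF(x)=F(x+\delta_y)-F(x)$, $D^n_{y_1,\dots,y_n}F=D_{y_1}D^{n-1}_{y_2,\dots,y_n}F$, set $$\mathcal E_\mu(y_1,\dots,y_m)=\exp\Big(\nu\cdot\Big[\sum_{i}D_{y_i}G(\mu)+\sum_{i<j}D^2_{y_iy_j}G(\mu)+\sum_{i<j<k}D^3_{y_iy_jy_k}G(\mu)\Big]\Big),$$ with all indices running over $1,\dots,m$. Then $p$ is a probability density, all expectations and integrals below exist and are finite, and, writing $S,L,N$ for $S(\mu),L(\mu),N(\mu)$, $$\mathbb E S=\int_Y\mathbb E[\mathcal E_\mu(y)]A(y)\,\lambda(dy),$$ $$\mathbb E L=\frac12\int_{Y^2}\mathbb E[\mathcal E_\mu(y_1,y_2)]\,l(y_1\cap y_2)\,\lambda(d(y_1,y_2)),$$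 $$\mathbb E N=\frac16\int_{Y^3}\mathbb E[\mathcal E_\mu(y_1,y_2,y_3)]\,1_{[y_1\cap y_2\cap y_3\ne\emptyset]}\,\lambda(d(y_1,y_2,y_3)),$$ $$\mathbb E[S^2]=\int_{Y^2}\mathbb E[\mathcal E_\mu(y_1,y_2)]A(y_1)A(y_2)\,\lambda(d(y_1,y_2))+\int_Y\mathbb E[\mathcal E_\mu(y)]A(y)^2\,\lambda(dy),$$ $$\mathbb E[L^2]=\frac14\int_{Y^4}\mathbb E[\mathcal E_\mu(y_1,\dots,y_4)]\,l(y_1\cap y_2)\,l(y_3\cap y_4)\,\lambda(d(y_1,\dots,y_4))$$ $$+\int_{Y^3}\mathbb E[\mathcal E_\mu(y_1,y_2,y_3)]\,l(y_1\cap y_2)\,l(y_3\cap y_1)\,\lambda(d(y_1,y_2,y_3))+\frac12\int_{Y^2}\mathbb E[\mathcal E_\mu(y_1,y_2)]\,l(y_1\cap y_2)^2\,\lambda(d(y_1,y_2)),$$ $$\mathbb E[N^2]=\frac1{36}\int_{Y^6}\mathbb E[\mathcal E_\mu(y_1,\dots,y_6)]\,1_{[y_1\cap y_2\cap y_3\ne\emptyset]}1_{[y_4\cap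 y_5\cap y_6\ne\emptyset]}\,\lambda(d(y_1,\dots,y_6))$$ $$+\frac14\int_{Y^5}\mathbb E[\mathcal E_\mu(y_1,\dots,y_5)]\,1_{[y_1\cap y_2\cap y_3\ne\emptyset]}1_{[y_4\cap y_5\cap y_1\ne\emptyset]}\,\lambda(d(y_1,\dots,y_5))$$ $$+\frac12\int_{Y^4}\mathbb E[\mathcal E_\mu(y_1,\dots,y_4)]\,1_{[y_1\cap y_2\cap y_3\ne\emptyset]}1_{[y_4\cap y_2\cap y_1\ne\emptyset]}\,\lambda(d(y_1,\dots,y_4))+\frac16\int_{Y^3}\mathbb E[\mathcal E_\mu(y_1,y_2,y_3)]\,1_{[y_1\cap y_2\cap y_3\ne\emptyset]}\,\lambda(d(y_1,y_2,y_3)).$$ -/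

import Mathlib

open MeasureTheory
open scoped NNReal ENNReal

noncomputable section

/-! ### Finite point configurations and the finite Poisson process -/

section PointProcesses

/-- Finite point configurations on `Y`, i.e. finite integer-valued measures, written as multisets
(`x` stands for the sum of the Dirac measures at its points, with multiplicity). -/
abbrev Config (Y : Type*) : Type _ := Multiset Y

variable {Y : Type*}

open Classical in
/-- The number `x(A)` of points of the configuration `x` in the set `A`. -/
def countIn (A : Set Y) (x : Config Y) : ℕ := Multiset.countP (fun y => y ∈ A) x

/-- The smallest σ-algebra on configurations that makes every counting map `x ↦ x(A)`, `A`
measurable, measurable. -/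
instance Config.instMeasurableSpace [MeasurableSpace Y] : MeasurableSpace (Config Y) :=
  ⨆ A : {A : Set Y // MeasurableSet A}, MeasurableSpace.comap (countIn A.1) ⊤

/-- The configuration `δ_{v 0} + ⋯ + δ_{v (n - 1)}` of the points of an `n`-tuple. -/
def ofTuple {n : ℕ} (v : Fin n → Y) : Config Y := Multiset.ofList (List.ofFn v)

lemma countIn_ofTuple {n : ℕ} (A : Set Y) (v : Fin n → Y) :
    countIn A (ofTuple v) = ∑ i, A.indicator (fun _ => 1) (v i) := by
  classical
  unfold countIn ofTuple
  induction n with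
  | zero => simp
  | succ n ih =>
    rw [Fin.sum_univ_succ, ← ih (fun i => v i.succ), List.ofFn_succ, ← Multiset.cons_coe,
      Multiset.countP_cons, add_comm]
    simp [Set.indicator_apply]

lemma measurable_ofTuple [MeasurableSpace Y] (n : ℕ) :
    Measurable (ofTuple : (Fin n → Y) → Config Y) := by
  refine measurable_iff_comap_le.2 ?_
  rw [Config.instMeasurableSpace, MeasurableSpace.comap_iSup]
  refine iSup_le fun A => ?_
  rw [MeasurableSpace.comap_comp, ← measurable_iff_comap_le]
  have h : countIn A.1 ∘ (ofTuple : (Fin n → Y) → Config Y) =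
      fun v => ∑ i, A.1.indicator (fun _ => 1) (v i) := funext fun v => countIn_ofTuple A.1 v
  rw [h]
  exact Finset.measurable_sum _ fun i _ =>
    (measurable_const.indicator A.2).comp (measurable_pi_apply i)

/-- The law of the Poisson process with finite intensity measure `Λ`: the number of points is
Poisson distributed with mean `Λ(Y)` and, given that there are `n` points, these are independent
with distribution `Λ / Λ(Y)`; that is, `e^{-Λ(Y)} ∑ₙ (1 / n!) Λⁿ` carried over to configurations. -/
def poissonLaw [MeasurableSpace Y] (Λ : Measure Y) : Measure (Config Y) :=
  ENNReal.ofReal (Real.exp (-(Λ.real Set.univ))) •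
    Measure.sum fun n : ℕ =>
      ((n.factorial : ℝ≥0∞)⁻¹) • (Measure.pi fun _ : Fin n => Λ).map ofTuple

open Classical in
/-- The sum of `f` over all ordered `k`-tuples of different points of the configuration `x`
(a point of multiplicity `j` counts as `j` different points). -/
def sumDistinct (k : ℕ) (f : (Fin k → Y) → ℝ) (x : Config Y) : ℝ :=
  ∑ v : Fin k ↪ x.ToType, f fun i => (v i).1

/-- The difference operator `D_y F(x) = F(x + δ_y) - F(x)`. -/
def diffOp {M : Type*} [Sub M] (y : Y) (F : Config Y → M) (x : Config Y) : M :=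
  F (y ::ₘ x) - F x

end PointProcesses

/-! ### Circular plates in three-dimensional space -/

section Plates

/-- Three-dimensional Euclidean space. -/
abbrev E3 : Type := EuclideanSpace ℝ (Fin 3)

/-- The (closed) unit hemisphere. -/
def hemisphere : Set E3 := {φ | ‖φ‖ = 1 ∧ 0 ≤ φ 2}

/-- The space `B × (0, b] × 𝕊²` of plates, with coordinates (centre, radius, unit normal). -/
abbrev PlateSpace (B : Set E3) (b : ℝ) : Type := B × Set.Ioc (0 : ℝ) b × hemisphere

variable {B : Set E3} {b : ℝ}

/-- The plate with the given centre, radius and normal, as a subset of space. -/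
def plate (y : PlateSpace B b) : Set E3 :=
  {w | dist w (y.1 : E3) ≤ (y.2.1 : ℝ) ∧ inner ℝ (y.2.2 : E3) (w - (y.1 : E3)) = 0}

/-- The intensity measure `ρ(z) dz Q(dr) V(dφ)` on the space of plates. -/
def plateIntensity (ρ : B → ℝ≥0) (Q : Measure (Set.Ioc (0 : ℝ) b)) (V : Measure hemisphere) :
    Measure (PlateSpace B b) :=
  (((volume : Measure E3).comap (Subtype.val : B → E3)).withDensity fun z => (ρ z : ℝ≥0∞)).prod (Q.prod V)

/-- The area of a plate. -/
def area (y : PlateSpace B b) : ℝ := Real.pi * (y.2.1 : ℝ) ^ 2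

/-- The length (one-dimensional Hausdorff measure) of the intersection of two plates. -/
def len (s t : PlateSpace B b) : ℝ := (μH[1] (plate s ∩ plate t)).toReal

open Classical in
/-- The indicator of the event that three plates have a common point. -/
def meet (s t u : PlateSpace B b) : ℝ :=
  if (plate s ∩ plate t ∩ plate u).Nonempty then 1 else 0

/-- The total area of the plates. -/
def totalArea (x : Config (PlateSpace B b)) : ℝ := sumDistinct 1 (fun y => area (y 0)) x

/-- The total length of the intersections of pairs of plates. -/
def totalLength (x : Config (PlateSpace B b)) : ℝ :=
  1 / 2 * sumDistinct 2 (fun y => len (y 0) (y 1)) x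

/-- The number of intersection points of triplets of plates. -/
def triplePoints (x : Config (PlateSpace B b)) : ℝ :=
  1 / 6 * sumDistinct 3 (fun y => meet (y 0) (y 1) (y 2)) x

/-- The vector `G = (S, L, N)`. -/
def plateG (x : Config (PlateSpace B b)) : Fin 3 → ℝ :=
  ![totalArea x, totalLength x, triplePoints x]

/-- The unnormalized density `exp(ν · G)`. -/
def gibbsWeight (ν : Fin 3 → ℝ) (x : Config (PlateSpace B b)) : ℝ :=
  Real.exp (∑ i, ν i * plateG x i)

/-- The law of the plate process: density `c⁻¹ exp(ν · G)` with respect to the Poisson process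
with intensity measure `Λ`, where `c` is the normalizing constant. -/
def plateLaw (Λ : Measure (PlateSpace B b)) (ν : Fin 3 → ℝ) : Measure (Config (PlateSpace B b)) :=
  (poissonLaw Λ).withDensity fun x =>
    ENNReal.ofReal ((∫ x', gibbsWeight ν x' ∂(poissonLaw Λ))⁻¹ * gibbsWeight ν x)

/-- `Q_m = ∑ D_{y_i} G + ∑_{i<j} D²_{y_i y_j} G + ∑_{i<j<l} D³_{y_i y_j y_l} G`. -/
def plateQ {m : ℕ} (y : Fin m → PlateSpace B b) (x : Config (PlateSpace B b)) : Fin 3 → ℝ :=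
  (∑ i, diffOp (y i) plateG x)
    + (∑ i, ∑ j ∈ Finset.Ioi i, diffOp (y i) (diffOp (y j) plateG) x)
    + ∑ i, ∑ j ∈ Finset.Ioi i, ∑ l ∈ Finset.Ioi j,
        diffOp (y i) (diffOp (y j) (diffOp (y l) plateG)) x

/-- `𝓔_x(y_1, …, y_m) = exp(ν · Q_m)`. -/
def plateE (ν : Fin 3 → ℝ) {m : ℕ} (y : Fin m → PlateSpace B b)
    (x : Config (PlateSpace B b)) : ℝ :=
  Real.exp (∑ i, ν i * plateQ y x i)

/-- `∫ 𝔼[𝓔_μ(y_1, …, y_m)] h(y_1, …, y_m) Λ(d(y_1, …, y_m))` for the plate process `μ`. -/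
def plateIntegral (Λ : Measure (PlateSpace B b)) (ν : Fin 3 → ℝ) {m : ℕ}
    (h : (Fin m → PlateSpace B b) → ℝ) : ℝ :=
  ∫ y, (∫ x, plateE ν y x ∂(plateLaw Λ ν)) * h y ∂(Measure.pi fun _ => Λ)

/-- The expectation (for almost all `y`) and the integral in `plateIntegral` exist. -/
def PlateIntegrable (Λ : Measure (PlateSpace B b)) (ν : Fin 3 → ℝ) {m : ℕ}
    (h : (Fin m → PlateSpace B b) → ℝ) : Prop :=
  (∀ᵐ y ∂(Measure.pi fun _ : Fin m => Λ), Integrable (plateE ν y) (plateLaw Λ ν)) ∧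
    Integrable (fun y => (∫ x, plateE ν y x ∂(plateLaw Λ ν)) * h y) (Measure.pi fun _ => Λ)

end Plates

end

/-! `totalArea`, `totalLength` and `triplePoints` are, up to constants, sums of a bounded
nonnegative kernel over tuples of distinct points. The square of such a sum is again a combination
of such sums, sorted by how many points the two tuples share (`sumDistinct_sq_one`,
`sumDistinct_sq_two`, `sumDistinct_sq_three`). So everything reduces to one formula for the mean of
`sumDistinct k f`, which is `plateLaw_sumDistinct`.

That formula is the multivariate Mecke equation `lintegral_sumDistinct_mul_poissonLaw` applied with
the Gibbs weight as the second factor: summing over points of the Poisson process amounts to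
integrating over added points `y`, with the weight evaluated at `ofTuple y + x`. A difference
operator lowers the order of a sum over distinct tuples by one, so the fourth differences of
`plateG` vanish and its increment under adding `y` is exactly `plateQ y`. Hence the shifted weight
is `plateE ν y` times the original one (`plateE_mul_gibbsWeight`), and dividing by the normalizing
constant gives `plateIntegral`.

Finiteness holds because `ν 1` and `ν 2` are nonpositive, so the weight grows at most exponentially
in the number of plates, and a Poisson variable has all exponential moments. Measurability of `len`
comes from geometry: off the closed set of parallel pairs it is the diameter of the intersection,
and on that set it is zero. -/

/-! ### Sums over tuples of distinct indices -/

section EmbeddingSums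

variable {ι M : Type*} [Fintype ι] [AddCommMonoid M]

open Classical in
/-- The sum of `F` over all injective `k`-tuples of indices. -/
noncomputable def embSum (k : ℕ) (F : (Fin k → ι) → M) : M := ∑ e : Fin k ↪ ι, F e

lemma embSum_congr {k : ℕ} {F G : (Fin k → ι) → M} (h : ∀ e, Function.Injective e → F e = G e) :
    embSum k F = embSum k G :=
  Finset.sum_congr rfl fun e _ => h e e.injective

lemma embSum_zero (F : (Fin 0 → ι) → M) : embSum 0 F = F ![] := by
  classical
  have : Unique (Fin 0 ↪ ι) := ⟨⟨Function.Embedding.ofIsEmpty⟩, fun a => by ext i; exact i.elim0⟩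
  rw [embSum, Fintype.sum_unique]
  congr 1
  ext i
  exact i.elim0

lemma embSum_sum {α : Type*} (s : Finset α) {k : ℕ} (F : α → (Fin k → ι) → M) :
    embSum k (fun e => ∑ a ∈ s, F a e) = ∑ a ∈ s, embSum k (F a) := by
  simp only [embSum]
  exact Finset.sum_comm

/-- An additional index either differs from those of the tuple or is one of them. -/
lemma sum_embSum {k : ℕ} (h : ι → (Fin k → ι) → M) :
    ∑ a, embSum k (h a) =
      embSum (k + 1) (fun e => h (e 0) (Fin.tail e)) + ∑ i, embSum k fun e => h (e i) e := by
  classical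
  have h1 : ∀ e : Fin k ↪ ι, ∑ a, h a e =
      (∑ a : {i // i ∉ Set.range e}, h a e) + ∑ i, h (e i) e := by
    intro e
    have h2 : ∑ i, h (e i) e = ∑ a : {i // i ∈ Set.range e}, h a e :=
      Fintype.sum_equiv (Equiv.ofInjective e e.injective) _ _ fun i => rfl
    rw [h2, add_comm]
    convert (Fintype.sum_subtype_add_sum_subtype (fun i => i ∈ Set.range e) fun a => h a e).symm
  rw [← embSum_sum, ← embSum_sum]
  simp only [embSum, h1, Finset.sum_add_distrib]
  congr 1
  rw [← Fintype.sum_sigma' (fun (e : Fin k ↪ ι) (a : {i // i ∉ Set.range e}) => h a e)]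
  refine (Fintype.sum_equiv (Equiv.embeddingFinSucc k ι) _ _ fun e => ?_).symm
  rfl

lemma embSum_comp_injective {k : ℕ} (w : Fin k → Fin k) (hw : Function.Injective w)
    (F : (Fin k → ι) → M) : embSum k (fun e => F fun i => e (w i)) = embSum k F := by
  classical
  let σ : Equiv.Perm (Fin k) := Equiv.ofBijective w (Finite.injective_iff_bijective.1 hw)
  refine Fintype.sum_equiv (σ.symm.embeddingCongr (Equiv.refl ι)) _ _ fun e => ?_
  congr 1

/-- An injective self-map of `Fin k` is a permutation. Asking only for injectivity lets `decide`
handle the explicit relabellings below. -/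
lemma embSum_eq_of_perm {k : ℕ} {F G : (Fin k → ι) → M} (w : Fin k → Fin k)
    (hw : Function.Injective w) (h : ∀ e, F e = G fun i => e (w i)) : embSum k F = embSum k G := by
  rw [← embSum_comp_injective w hw G]
  exact embSum_congr fun e _ => h e

lemma embSum_comp_equiv {κ : Type*} [Fintype κ] (σ : ι ≃ κ) {k : ℕ} (F : (Fin k → κ) → M) :
    embSum k (fun e : Fin k → ι => F (σ ∘ e)) = embSum k F := by
  classical
  exact Fintype.sum_equiv ((Equiv.refl _).embeddingCongr σ) _ _ fun e => rfl

lemma embSum_one (f : ι → M) : embSum 1 (fun e => f (e 0)) = ∑ a, f a := by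
  have := sum_embSum (k := 0) (fun a (_ : Fin 0 → ι) => f a)
  simpa [embSum_zero] using this.symm

/-- A kernel that vanishes on repeated indices does not see the restriction to injective tuples. -/
lemma embSum_two {f : ι → ι → M} (hd : ∀ a, f a a = 0) :
    embSum 2 (fun e => f (e 0) (e 1)) = ∑ a, ∑ b, f a b := by
  simp_rw [← embSum_one (f _)]
  rw [sum_embSum]
  simp [hd, embSum, Fin.tail]

lemma embSum_three {f : ι → ι → ι → M} (h1 : ∀ a b, f a a b = 0) (h2 : ∀ a b, f a b a = 0)
    (h3 : ∀ a b, f a b b = 0) :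
    embSum 3 (fun e => f (e 0) (e 1) (e 2)) = ∑ a, ∑ b, ∑ c, f a b c := by
  simp_rw [← embSum_two (h3 _)]
  rw [sum_embSum]
  simp [h1, h2, embSum, Fin.tail]

end EmbeddingSums

/-! ### Squares of sums over distinct indices. -/

section Products

variable {ι : Type*} [Fintype ι]

lemma embSum_const_mul (c : ℝ) {k : ℕ} (F : (Fin k → ι) → ℝ) :
    embSum k (fun e => c * F e) = c * embSum k F := by
  simp [embSum, Finset.mul_sum]

lemma sq_embSum_one (f : ι → ℝ) :
    embSum 1 (fun e => f (e 0)) ^ 2 =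
      embSum 2 (fun e => f (e 0) * f (e 1)) + embSum 1 (fun e => f (e 0) ^ 2) := by
  rw [sq]
  nth_rw 1 [embSum_one]
  rw [Finset.sum_mul]
  simp_rw [← embSum_const_mul]
  rw [sum_embSum]
  simp [Fin.tail, sq]

lemma embSum_const_zero {k : ℕ} : embSum k (fun _ : Fin k → ι => (0 : ℝ)) = 0 := by
  simp [embSum]

/-- Two pairs share `j` indices in `(2 choose j)² j!` ways, which gives the coefficients 1, 4, 2.
Symmetry of `g` brings all these ways to one form. -/
lemma sq_embSum_two {g : ι → ι → ℝ} (hs : ∀ a b, g a b = g b a) (hd : ∀ a, g a a = 0) :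
    embSum 2 (fun e => g (e 0) (e 1)) ^ 2 =
      embSum 4 (fun e => g (e 0) (e 1) * g (e 2) (e 3)) +
      4 * embSum 3 (fun e => g (e 0) (e 1) * g (e 2) (e 0)) +
      2 * embSum 2 (fun e => g (e 0) (e 1) ^ 2) := by
  -- Here `e 0` is the one index of the first factor that is new, and `p` marks the index of the
  -- second factor with which the other one coincides.
  have h1 : ∀ p : Fin 3, p ≠ 0 → embSum 3 (fun e : Fin 3 → ι => g (e p) (e 0) * g (e 1) (e 2)) =
      embSum 3 (fun e => g (e 0) (e 1) * g (e 2) (e 0)) := by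
    intro p hp
    obtain rfl | rfl : p = 1 ∨ p = 2 := by lia
    · exact embSum_eq_of_perm ![1, 0, 2] (by decide) fun e => by simp [hs (e 2) (e 1)]
    · exact embSum_eq_of_perm ![2, 0, 1] (by decide) fun e => by simp
  have h2 : ∀ p : Fin 3, p ≠ 0 → embSum 3 (fun e : Fin 3 → ι => g (e 0) (e p) * g (e 1) (e 2)) =
      embSum 3 (fun e => g (e 0) (e 1) * g (e 2) (e 0)) := by
    intro p hp
    rw [← h1 p hp]
    exact embSum_congr fun e _ => by rw [hs (e 0) (e p)]
  have h3 : ∀ e : Fin 2 → ι, g (e 1) (e 0) = g (e 0) (e 1) := fun e => hs _ _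
  rw [sq]
  -- Only the first factor becomes a free double sum. Its indices are then adjoined one by one to
  -- the tuple of the second factor.
  nth_rw 1 [embSum_two hd]
  simp_rw [Finset.sum_mul, ← embSum_const_mul, sum_embSum, Finset.sum_add_distrib]
  rw [sum_embSum]
  simp only [Fin.tail, Fin.sum_univ_succ, sum_embSum, Finset.sum_add_distrib]
  simp [hd, embSum_const_mul, embSum_const_zero, h1, h2, h3, ← sq]
  ring

/-- Two triples share `j` indices in `(3 choose j)² j!` ways: 1, 9, 18, 6. -/
lemma sq_embSum_three {g : ι → ι → ι → ℝ} (hs : ∀ a b c, g a b c = g b a c)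
    (hs' : ∀ a b c, g a b c = g a c b) (hd : ∀ a b, g a a b = 0) :
    embSum 3 (fun e => g (e 0) (e 1) (e 2)) ^ 2 =
      embSum 6 (fun e => g (e 0) (e 1) (e 2) * g (e 3) (e 4) (e 5)) +
      9 * embSum 5 (fun e => g (e 0) (e 1) (e 2) * g (e 3) (e 4) (e 0)) +
      18 * embSum 4 (fun e => g (e 0) (e 1) (e 2) * g (e 3) (e 1) (e 0)) +
      6 * embSum 3 (fun e => g (e 0) (e 1) (e 2) ^ 2) := by
  have hr : ∀ a b c, g a b c = g b c a := fun a b c => by rw [hs, hs']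
  have hr' : ∀ a b c, g a b c = g c a b := fun a b c => by rw [hs', hs]
  have hf : ∀ a b c, g a b c = g c b a := fun a b c => by rw [hr, hs]
  have hd2 : ∀ a b, g a b a = 0 := fun a b => by rw [hs', hd]
  have hd3 : ∀ a b, g a b b = 0 := fun a b => by rw [hs, hd2]
  -- One shared index, namely `e p`; `h5`, `h5'` and `h5''` differ in its slot in the first factor.
  have h5 : ∀ p : Fin 5, p = 2 ∨ p = 3 ∨ p = 4 →
      embSum 5 (fun e : Fin 5 → ι => g (e p) (e 0) (e 1) * g (e 2) (e 3) (e 4)) =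
        embSum 5 (fun e => g (e 0) (e 1) (e 2) * g (e 3) (e 4) (e 0)) := by
    rintro p (rfl | rfl | rfl)
    · exact embSum_eq_of_perm ![2, 0, 1, 3, 4] (by decide) fun e => by
        simpa using .inl (hr _ _ _)
    · exact embSum_eq_of_perm ![3, 0, 1, 4, 2] (by decide) fun e => by
        simpa using .inl (hr' _ _ _)
    · exact embSum_eq_of_perm ![4, 0, 1, 2, 3] (by decide) fun e => by simp
  have h5' : ∀ p : Fin 5, p = 2 ∨ p = 3 ∨ p = 4 →
      embSum 5 (fun e : Fin 5 → ι => g (e 0) (e p) (e 1) * g (e 2) (e 3) (e 4)) =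
        embSum 5 (fun e => g (e 0) (e 1) (e 2) * g (e 3) (e 4) (e 0)) := by
    intro p hp
    rw [← h5 p hp]
    exact embSum_congr fun e _ => by rw [hs (e 0) (e p)]
  have h5'' : ∀ p : Fin 5, p = 2 ∨ p = 3 ∨ p = 4 →
      embSum 5 (fun e : Fin 5 → ι => g (e 0) (e 1) (e p) * g (e 2) (e 3) (e 4)) =
        embSum 5 (fun e => g (e 0) (e 1) (e 2) * g (e 3) (e 4) (e 0)) := by
    intro p hp
    rw [← h5' p hp]
    exact embSum_congr fun e _ => by rw [hs' (e 0) (e 1) (e p)]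
  -- Two shared indices, `e p` and `e q`; the three variants differ in the slot of the new index `e
  -- 0`.
  have h4 : ∀ p q : Fin 4, p ≠ 0 → q ≠ 0 → p ≠ q →
      embSum 4 (fun e : Fin 4 → ι => g (e p) (e q) (e 0) * g (e 1) (e 2) (e 3)) =
        embSum 4 (fun e => g (e 0) (e 1) (e 2) * g (e 3) (e 1) (e 0)) := by
    intro p q hp hq hpq
    have : (p = 1 ∨ p = 2 ∨ p = 3) ∧ (q = 1 ∨ q = 2 ∨ q = 3) := by lia
    rcases this with ⟨rfl | rfl | rfl, rfl | rfl | rfl⟩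
    · exact absurd rfl hpq
    · exact embSum_eq_of_perm ![1, 2, 0, 3] (by decide) fun e => by simpa using .inl (hf _ _ _)
    · exact embSum_eq_of_perm ![1, 3, 0, 2] (by decide) fun e => by simpa using .inl (hr _ _ _)
    · exact embSum_eq_of_perm ![2, 1, 0, 3] (by decide) fun e => by simpa using .inl (hr' _ _ _)
    · exact absurd rfl hpq
    · exact embSum_eq_of_perm ![2, 3, 0, 1] (by decide) fun e => by simpa using .inl (hs' _ _ _)
    · exact embSum_eq_of_perm ![3, 1, 0, 2] (by decide) fun e => by simpa using .inl (hs _ _ _)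
    · exact embSum_eq_of_perm ![3, 2, 0, 1] (by decide) fun e => by simp
    · exact absurd rfl hpq
  have h4' : ∀ p q : Fin 4, p ≠ 0 → q ≠ 0 → p ≠ q →
      embSum 4 (fun e : Fin 4 → ι => g (e p) (e 0) (e q) * g (e 1) (e 2) (e 3)) =
        embSum 4 (fun e => g (e 0) (e 1) (e 2) * g (e 3) (e 1) (e 0)) := by
    intro p q hp hq hpq
    rw [← h4 p q hp hq hpq]
    exact embSum_congr fun e _ => by rw [hs' (e p) (e 0) (e q)]
  have h4'' : ∀ p q : Fin 4, p ≠ 0 → q ≠ 0 → p ≠ q →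
      embSum 4 (fun e : Fin 4 → ι => g (e 0) (e p) (e q) * g (e 1) (e 2) (e 3)) =
        embSum 4 (fun e => g (e 0) (e 1) (e 2) * g (e 3) (e 1) (e 0)) := by
    intro p q hp hq hpq
    rw [← h4' p q hp hq hpq]
    exact embSum_congr fun e _ => by rw [hs (e 0) (e p) (e q)]
  have h3 : ∀ e : Fin 3 → ι, g (e 0) (e 2) (e 1) = g (e 0) (e 1) (e 2) ∧
      g (e 1) (e 0) (e 2) = g (e 0) (e 1) (e 2) ∧ g (e 1) (e 2) (e 0) = g (e 0) (e 1) (e 2) ∧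
      g (e 2) (e 0) (e 1) = g (e 0) (e 1) (e 2) ∧ g (e 2) (e 1) (e 0) = g (e 0) (e 1) (e 2) :=
    fun e => ⟨hs' _ _ _, hs _ _ _, hr' _ _ _, hr _ _ _, hf _ _ _⟩
  rw [sq]
  nth_rw 1 [embSum_three hd hd2 hd3]
  simp_rw [Finset.sum_mul, ← embSum_const_mul, sum_embSum, Finset.sum_add_distrib]
  simp only [Fin.tail, Fin.sum_univ_succ, sum_embSum, Finset.sum_add_distrib]
  simp only [Fin.isValue, Fin.succ_zero_eq_one, Fin.succ_one_eq_two, Fin.reduceSucc, hd, hd2, hd3,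
    zero_mul, embSum_const_mul, Finset.univ_eq_empty, Finset.sum_empty, add_zero]
  simp [embSum_const_zero, h3, h4, h4', h4'', h5, h5', h5'', ← sq]
  ring

end Products

/-! ### Sums over distinct points of a configuration -/

section Configurations

open scoped Classical

variable {Y ι : Type*} [Fintype ι]

/-- Lets `sumDistinct` be computed from any enumeration of the configuration with multiplicity: `Fin
n` for a tuple, `Option x.ToType` after adding a point. -/
lemma exists_equiv_toType {x : Config Y} {v : ι → Y} (h : Finset.univ.val.map v = x) :
    ∃ σ : ι ≃ x.ToType, ∀ i, (σ i).1 = v i := by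
  classical
  subst h
  let u : Multiset ι := (Finset.univ : Finset ι).val
  have hb : Function.Bijective (fun z : u.ToType => z.1) := by
    rw [Fintype.bijective_iff_surjective_and_card]
    refine ⟨fun i => ?_, by simp [u]⟩
    have hi : 0 < u.count i := Multiset.count_pos.2 (Finset.mem_univ i)
    exact ⟨⟨i, ⟨0, hi⟩⟩, rfl⟩
  refine ⟨(Equiv.ofBijective _ hb).symm.trans (u.mapEquiv v), fun i => ?_⟩
  obtain ⟨z, rfl⟩ := hb.2 i
  have : (Equiv.ofBijective _ hb).symm z.1 = z := (Equiv.ofBijective _ hb).symm_apply_apply z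
  simp only [Equiv.trans_apply, this]
  exact Multiset.mapEquiv_apply u v z

lemma sumDistinct_eq_embSum {x : Config Y} {v : ι → Y} (h : Finset.univ.val.map v = x) (k : ℕ)
    (f : (Fin k → Y) → ℝ) : sumDistinct k f x = embSum k fun e => f fun i => v (e i) := by
  obtain ⟨σ, hσ⟩ := exists_equiv_toType h
  simp_rw [← hσ]
  exact (embSum_comp_equiv σ fun e => f fun i => (e i).1).symm

lemma ofTuple_eq_map {n : ℕ} (v : Fin n → Y) : ofTuple v = Finset.univ.val.map v := by
  simp [ofTuple, Fin.univ_val_map]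

lemma ofTuple_succ {n : ℕ} (v : Fin (n + 1) → Y) :
    ofTuple v = v 0 ::ₘ ofTuple fun i => v i.succ := by
  simp [ofTuple, List.ofFn_succ]

lemma map_val_toType (x : Config Y) :
    (Finset.univ : Finset x.ToType).val.map (fun z => z.1) = x := Multiset.map_univ_coe x

lemma map_option_toType (y : Y) (x : Config Y) :
    (Finset.univ : Finset (Option x.ToType)).val.map (fun z => z.elim y fun z => z.1) =
      y ::ₘ x := by
  simp only [univ_option, Finset.insertNone, OrderEmbedding.coe_ofMapLEIff, Finset.cons_val,
    Finset.map_val, Multiset.map_cons, Multiset.map_map, Function.comp_def, Option.elim,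
    Function.Embedding.some_apply]
  rw [map_val_toType]

lemma sumDistinct_zero (f : (Fin 0 → Y) → ℝ) (x : Config Y) : sumDistinct 0 f x = f ![] := by
  rw [sumDistinct_eq_embSum (map_val_toType x), embSum_zero]
  congr 1
  ext i
  exact i.elim0

/-- `f`, set to zero at tuples that are not injective. -/
noncomputable def distinctTwo (f : ι → ι → ℝ) (a b : ι) : ℝ := if a = b then 0 else f a b

/-- `f`, set to zero at tuples that are not injective. -/
noncomputable def distinctThree (f : ι → ι → ι → ℝ) (a b c : ι) : ℝ :=
  if a = b ∨ a = c ∨ b = c then 0 else f a b c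

lemma embSum_distinctTwo (f : ι → ι → ℝ) :
    embSum 2 (fun e => f (e 0) (e 1)) = ∑ a, ∑ b, distinctTwo f a b := by
  rw [← embSum_two (f := distinctTwo f) (by simp [distinctTwo])]
  exact embSum_congr fun e he => by simp [distinctTwo, he.eq_iff]

lemma embSum_distinctThree (f : ι → ι → ι → ℝ) :
    embSum 3 (fun e => f (e 0) (e 1) (e 2)) = ∑ a, ∑ b, ∑ c, distinctThree f a b c := by
  rw [← embSum_three (f := distinctThree f) (by simp [distinctThree]) (by simp [distinctThree])
    (by simp [distinctThree])]
  exact embSum_congr fun e he => by simp [distinctThree, he.eq_iff]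

/-- In this lemma and the next two, the tuples that survive the difference are those using the added
point, and distinctness allows it in one slot only. So the order drops by one and the point is
inserted into each slot in turn. -/
lemma diffOp_sumDistinct_one (f : Y → ℝ) (y : Y) (x : Config Y) :
    diffOp y (sumDistinct 1 fun w => f (w 0)) x = f y := by
  rw [diffOp, sumDistinct_eq_embSum (map_val_toType x),
    sumDistinct_eq_embSum (map_option_toType y x), embSum_one fun z : x.ToType => f z.1,
    embSum_one fun z : Option x.ToType => f (z.elim y fun z => z.1)]
  simp

lemma diffOp_sumDistinct_two (f : Y → Y → ℝ) (y : Y) (x : Config Y) :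
    diffOp y (sumDistinct 2 fun w => f (w 0) (w 1)) x =
      sumDistinct 1 (fun w => f y (w 0) + f (w 0) y) x := by
  rw [diffOp, sumDistinct_eq_embSum (map_val_toType x),
    sumDistinct_eq_embSum (map_option_toType y x), sumDistinct_eq_embSum (map_val_toType x),
    embSum_one fun z : x.ToType => f y z.1 + f z.1 y,
    embSum_distinctTwo fun z z' : x.ToType => f z.1 z'.1,
    embSum_distinctTwo fun z z' : Option x.ToType =>
      f (z.elim y fun z => z.1) (z'.elim y fun z => z.1)]
  simp [Fintype.sum_option, distinctTwo, Finset.sum_add_distrib]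
  ring

lemma diffOp_sumDistinct_three (f : Y → Y → Y → ℝ) (y : Y) (x : Config Y) :
    diffOp y (sumDistinct 3 fun w => f (w 0) (w 1) (w 2)) x =
      sumDistinct 2 (fun w => f y (w 0) (w 1) + f (w 0) y (w 1) + f (w 0) (w 1) y) x := by
  rw [diffOp, sumDistinct_eq_embSum (map_val_toType x),
    sumDistinct_eq_embSum (map_option_toType y x), sumDistinct_eq_embSum (map_val_toType x),
    embSum_distinctTwo fun z z' : x.ToType => f y z.1 z'.1 + f z.1 y z'.1 + f z.1 z'.1 y,
    embSum_distinctThree fun z z' z'' : x.ToType => f z.1 z'.1 z''.1,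
    embSum_distinctThree fun z z' z'' : Option x.ToType =>
      f (z.elim y fun z => z.1) (z'.elim y fun z => z.1) (z''.elim y fun z => z.1)]
  have h : ∀ a b : x.ToType,
      distinctTwo (fun z z' : x.ToType => f y z.1 z'.1 + f z.1 y z'.1 + f z.1 z'.1 y) a b =
      distinctTwo (fun z z' : x.ToType => f y z.1 z'.1) a b +
      distinctTwo (fun z z' : x.ToType => f z.1 y z'.1) a b +
      distinctTwo (fun z z' : x.ToType => f z.1 z'.1 y) a b := by
    intro a b
    simp only [distinctTwo]
    split_ifs <;> simp
  simp_rw [h, Finset.sum_add_distrib]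
  simp [Fintype.sum_option, distinctTwo, distinctThree, Finset.sum_add_distrib]
  ring

lemma sumDistinct_sq_one (f : Y → ℝ) (x : Config Y) :
    sumDistinct 1 (fun y => f (y 0)) x ^ 2 =
      sumDistinct 2 (fun y => f (y 0) * f (y 1)) x + sumDistinct 1 (fun y => f (y 0) ^ 2) x := by
  simp only [sumDistinct_eq_embSum (map_val_toType x)]
  exact sq_embSum_one fun z : x.ToType => f z.1

lemma sumDistinct_sq_two {f : Y → Y → ℝ} (hf : ∀ a b, f a b = f b a) (x : Config Y) :
    sumDistinct 2 (fun y => f (y 0) (y 1)) x ^ 2 =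
      sumDistinct 4 (fun y => f (y 0) (y 1) * f (y 2) (y 3)) x +
      4 * sumDistinct 3 (fun y => f (y 0) (y 1) * f (y 2) (y 0)) x +
      2 * sumDistinct 2 (fun y => f (y 0) (y 1) ^ 2) x := by
  simp only [sumDistinct_eq_embSum (map_val_toType x)]
  -- The kernel `f` need not vanish on the diagonal. Zeroing it there leaves sums over injective
  -- tuples unchanged and meets the hypothesis of `sq_embSum_two`.
  have key := sq_embSum_two (g := distinctTwo fun z z' : x.ToType => f z.1 z'.1)
    (fun a b => by simp [distinctTwo, hf a.1 b.1, eq_comm]) (by simp [distinctTwo])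
  convert key using 2
  · exact embSum_congr fun e he => by simp [distinctTwo, he.eq_iff]
  · congr 1
    · exact embSum_congr fun e he => by simp [distinctTwo, he.eq_iff]
    · congr 1
      exact embSum_congr fun e he => by simp [distinctTwo, he.eq_iff]
  · congr 1
    exact embSum_congr fun e he => by simp [distinctTwo, he.eq_iff]

lemma sumDistinct_sq_three {f : Y → Y → Y → ℝ} (hf : ∀ a b c, f a b c = f b a c)
    (hf' : ∀ a b c, f a b c = f a c b) (x : Config Y) :
    sumDistinct 3 (fun y => f (y 0) (y 1) (y 2)) x ^ 2 =
      sumDistinct 6 (fun y => f (y 0) (y 1) (y 2) * f (y 3) (y 4) (y 5)) x +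
      9 * sumDistinct 5 (fun y => f (y 0) (y 1) (y 2) * f (y 3) (y 4) (y 0)) x +
      18 * sumDistinct 4 (fun y => f (y 0) (y 1) (y 2) * f (y 3) (y 1) (y 0)) x +
      6 * sumDistinct 3 (fun y => f (y 0) (y 1) (y 2) ^ 2) x := by
  simp only [sumDistinct_eq_embSum (map_val_toType x)]
  have key := sq_embSum_three (g := distinctThree fun z z' z'' : x.ToType => f z.1 z'.1 z''.1)
    (fun a b c => by grind [distinctThree]) (fun a b c => by grind [distinctThree])
    (by simp [distinctThree])
  convert key using 2
  · exact embSum_congr fun e he => by simp [distinctThree, he.eq_iff]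
  · congr 1
    · congr 1
      · exact embSum_congr fun e he => by simp [distinctThree, he.eq_iff]
      · congr 1
        exact embSum_congr fun e he => by simp [distinctThree, he.eq_iff]
    · congr 1
      exact embSum_congr fun e he => by simp [distinctThree, he.eq_iff]
  · congr 1
    exact embSum_congr fun e he => by simp [distinctThree, he.eq_iff]

lemma sumDistinct_nonneg {k : ℕ} {f : (Fin k → Y) → ℝ} (hf : ∀ y, 0 ≤ f y) (x : Config Y) :
    0 ≤ sumDistinct k f x := Finset.sum_nonneg fun _ _ => hf _

/-! ### Difference operators -/

/-- A functional whose fourth differences vanish is determined by its differences up to the third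
order. -/
lemma eq_sum_diffOp {M : Type*} [AddCommGroup M] {F : Config Y → M}
    (hF : ∀ a b c d x, diffOp a (diffOp b (diffOp c (diffOp d F))) x = 0) {m : ℕ} (y : Fin m → Y)
    (x : Config Y) :
    F (ofTuple y + x) = F x + ((∑ i, diffOp (y i) F x)
      + (∑ i, ∑ j ∈ Finset.Ioi i, diffOp (y i) (diffOp (y j) F) x)
      + ∑ i, ∑ j ∈ Finset.Ioi i, ∑ l ∈ Finset.Ioi j,
        diffOp (y i) (diffOp (y j) (diffOp (y l) F)) x) := by
  induction m generalizing x with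
  | zero => simp [ofTuple]
  | succ m ih =>
    have hstep : ∀ (a : Y) (H : Config Y → M), H (a ::ₘ x) = H x + diffOp a H x := by
      intro a H
      simp [diffOp]
    have h4 : ∀ a b c d, diffOp b (diffOp c (diffOp d F)) (a ::ₘ x) =
        diffOp b (diffOp c (diffOp d F)) x := by
      intro a b c d
      rw [hstep a (diffOp b (diffOp c (diffOp d F))), hF, add_zero]
    -- The induction hypothesis is used at the base point `y 0 ::ₘ x`. Moving each difference back
    -- to `x` adds one with `y 0` in front, except at third order, where `h4` says that nothing
    -- changes.
    rw [ofTuple_succ, Multiset.cons_add, ← Multiset.add_cons, ih]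
    simp only [h4, hstep (y 0) F, hstep (y 0) (diffOp _ F), hstep (y 0) (diffOp _ (diffOp _ F)),
      Fin.sum_univ_succ, Fin.sum_Ioi_zero, Fin.sum_Ioi_succ, Finset.sum_add_distrib]
    abel

end Configurations

/-! ### Increments of `plateG` and of the Gibbs weight. -/

section PlateFunctionals

variable {B : Set E3} {b : ℝ}

/-- The components are sums of order at most three, so three differences leave a constant. -/
lemma diffOp_four_plateG (p q r s : PlateSpace B b) (x : Config (PlateSpace B b)) :
    diffOp p (diffOp q (diffOp r (diffOp s plateG))) x = 0 := by
  have h1 : ∀ (f : PlateSpace B b → ℝ) (y : PlateSpace B b),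
      diffOp y (sumDistinct 1 fun w => f (w 0)) = fun _ => f y :=
    fun f y => funext fun x => diffOp_sumDistinct_one f y x
  have h2 : ∀ (f : PlateSpace B b → PlateSpace B b → ℝ) (y : PlateSpace B b),
      diffOp y (sumDistinct 2 fun w => f (w 0) (w 1)) =
        sumDistinct 1 fun w => f y (w 0) + f (w 0) y :=
    fun f y => funext fun x => diffOp_sumDistinct_two f y x
  have h3 : ∀ (f : PlateSpace B b → PlateSpace B b → PlateSpace B b → ℝ) (y : PlateSpace B b),
      diffOp y (sumDistinct 3 fun w => f (w 0) (w 1) (w 2)) =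
        sumDistinct 2 fun w => f y (w 0) (w 1) + f (w 0) y (w 1) + f (w 0) (w 1) y :=
    fun f y => funext fun x => diffOp_sumDistinct_three f y x
  have h0 : ∀ (c : ℝ) (y : PlateSpace B b), diffOp y (fun _ : Config (PlateSpace B b) => c) =
      fun _ => 0 := fun c y => funext fun x => by simp [diffOp]
  have hc : ∀ (c : ℝ) (F : Config (PlateSpace B b) → ℝ) (y : PlateSpace B b),
      diffOp y (fun x => c * F x) = fun x => c * diffOp y F x :=
    fun c F y => funext fun x => by simp [diffOp, mul_sub]
  ext i
  change diffOp p (diffOp q (diffOp r (diffOp s fun x => plateG x i))) x = 0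
  fin_cases i
  · change diffOp p (diffOp q (diffOp r (diffOp s
      (sumDistinct 1 fun w : Fin 1 → PlateSpace B b => area (w 0))))) x = 0
    simp only [h1, h0]
  · change diffOp p (diffOp q (diffOp r (diffOp s fun x =>
      1 / 2 * (sumDistinct 2 fun w : Fin 2 → PlateSpace B b => len (w 0) (w 1)) x))) x = 0
    rw [hc, h2, hc, h1 fun z => len s z + len z s]
    simp only [h0]
  · change diffOp p (diffOp q (diffOp r (diffOp s fun x =>
      1 / 6 * (sumDistinct 3 fun w : Fin 3 → PlateSpace B b => meet (w 0) (w 1) (w 2)) x))) x = 0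
    rw [hc, h3, hc, h2 fun z w => meet s z w + meet z s w + meet z w s, hc,
      h1 fun z => meet s r z + meet r s z + meet r z s + (meet s z r + meet z s r + meet z r s)]
    simp only [h0]

lemma plateG_ofTuple_add {m : ℕ} (y : Fin m → PlateSpace B b) (x : Config (PlateSpace B b)) :
    plateG (ofTuple y + x) = plateG x + plateQ y x :=
  eq_sum_diffOp diffOp_four_plateG y x

lemma plateE_mul_gibbsWeight (ν : Fin 3 → ℝ) {m : ℕ} (y : Fin m → PlateSpace B b)
    (x : Config (PlateSpace B b)) :
    plateE ν y x * gibbsWeight ν x = gibbsWeight ν (ofTuple y + x) := by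
  rw [plateE, gibbsWeight, gibbsWeight, ← Real.exp_add, plateG_ofTuple_add,
    ← Finset.sum_add_distrib]
  congr 1
  exact Finset.sum_congr rfl fun i _ => by simp; ring

end PlateFunctionals

/-! ### Measurability of sums over distinct points. -/

section ConfigMeasurability

open scoped Classical

variable {Y : Type*}

lemma sum_toType (x : Config Y) (f : Y → ℝ) : ∑ z : x.ToType, f z.1 = (x.map f).sum := by
  conv_rhs => rw [← map_val_toType x, Multiset.map_map]
  rfl

lemma sum_indicator_toType (x : Config Y) (A : Set Y) :
    ∑ z : x.ToType, A.indicator (fun _ => (1 : ℝ)) z.1 = countIn A x := by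
  classical
  rw [sum_toType, countIn]
  induction x using Multiset.induction_on with
  | empty => simp
  | cons a x ih =>
    rw [Multiset.map_cons, Multiset.sum_cons, ih, Multiset.countP_cons]
    simp [Set.indicator_apply, add_comm]

variable [MeasurableSpace Y]

lemma measurable_countIn {A : Set Y} (hA : MeasurableSet A) :
    Measurable (countIn A : Config Y → ℕ) := by
  refine Measurable.mono (comap_measurable _) ?_ le_rfl
  exact le_iSup (fun A : {A : Set Y // MeasurableSet A} =>
    MeasurableSpace.comap (countIn A.1) ⊤) ⟨A, hA⟩

lemma measurable_card : Measurable fun x : Config Y => (x.card : ℝ) := by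
  have : (fun x : Config Y => (x.card : ℝ)) = fun x => (countIn Set.univ x : ℝ) := by
    ext x
    simp [countIn]
  rw [this]
  exact measurable_from_top.comp (measurable_countIn MeasurableSet.univ)

lemma measurable_config_iff {α : Type*} [MeasurableSpace α] {g : α → Config Y} :
    Measurable g ↔ ∀ A, MeasurableSet A → Measurable fun a => countIn A (g a) := by
  refine ⟨fun h A hA => (measurable_countIn hA).comp h, fun h => ?_⟩
  refine measurable_iff_comap_le.2 ?_
  rw [Config.instMeasurableSpace, MeasurableSpace.comap_iSup]
  refine iSup_le fun A => ?_
  rw [MeasurableSpace.comap_comp, ← measurable_iff_comap_le]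
  exact h A.1 A.2

lemma measurable_config_add :
    Measurable fun p : Config Y × Config Y => p.1 + p.2 := by
  classical
  refine measurable_config_iff.2 fun A hA => ?_
  have : (fun p : Config Y × Config Y => countIn A (p.1 + p.2)) =
      fun p => countIn A p.1 + countIn A p.2 := by
    ext p
    simp [countIn]
  rw [this]
  exact ((measurable_countIn hA).comp measurable_fst).add
    ((measurable_countIn hA).comp measurable_snd)

/-- For a box, choose the first point freely, which gives the factor `countIn (A 0) x`, and subtract
the cases where it is the `i`-th of the others. That point then lies in `A' i ∩ A 0`, so the
correction is again a sum over a box, of lower order. -/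
lemma measurable_sumDistinct_pi (k : ℕ) (A : Fin k → Set Y) (hA : ∀ i, MeasurableSet (A i)) :
    Measurable (sumDistinct k ((Set.univ.pi A).indicator fun _ => 1)) := by
  classical
  induction k with
  | zero =>
    have : sumDistinct 0 ((Set.univ.pi A).indicator fun _ => (1 : ℝ)) = fun _ => 1 := by
      ext x
      simp [sumDistinct_zero]
    rw [this]
    exact measurable_const
  | succ k ih =>
    let A' : Fin k → Set Y := fun i => A i.succ
    have hA' : ∀ i, MeasurableSet (A' i) := fun i => hA _
    let C : Fin k → Fin k → Set Y := fun i => Function.update A' i (A' i ∩ A 0)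
    have hC : ∀ i j, MeasurableSet (C i j) := by
      intro i j
      obtain rfl | h := eq_or_ne j i
      · simpa [C] using (hA' j).inter (hA 0)
      · simpa [C, h] using hA' j
    have key : ∀ x : Config Y, sumDistinct (k + 1) ((Set.univ.pi A).indicator fun _ => 1) x =
        countIn (A 0) x * sumDistinct k ((Set.univ.pi A').indicator fun _ => 1) x -
          ∑ i, sumDistinct k ((Set.univ.pi (C i)).indicator fun _ => 1) x := by
      intro x
      have h := sum_embSum (ι := x.ToType) (k := k) fun a e =>
        (A 0).indicator (fun _ => (1 : ℝ)) a.1 *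
        (Set.univ.pi A').indicator (fun _ => 1) fun i => (e i).1
      simp_rw [embSum_const_mul, ← Finset.sum_mul, sum_indicator_toType] at h
      simp_rw [sumDistinct_eq_embSum (map_val_toType x)]
      rw [h, eq_sub_iff_add_eq]
      congr 1
      · refine embSum_congr fun e _ => ?_
        simp [Set.indicator_apply, Set.mem_pi, Fin.forall_fin_succ, A', Fin.tail, ite_and]
        split_ifs <;> rfl
      · refine Finset.sum_congr rfl fun i _ => embSum_congr fun e _ => ?_
        have : (∀ j, (e j).1 ∈ C i j) ↔ (e i).1 ∈ A 0 ∧ ∀ j, (e j).1 ∈ A' j := by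
          simp only [C]
          rw [Function.forall_update_iff A' (p := fun j s => (e j).1 ∈ s)]
          refine ⟨fun ⟨h1, h2⟩ => ⟨h1.2, fun j => ?_⟩,
            fun ⟨h1, h2⟩ => ⟨⟨h2 i, h1⟩, fun j _ => h2 j⟩⟩
          obtain rfl | h := eq_or_ne j i
          exacts [h1.1, h2 j h]
        simp [Set.indicator_apply, Set.mem_pi, this, ite_and]
        split_ifs <;> rfl
    rw [funext key]
    refine Measurable.sub (Measurable.mul ?_ (ih _ hA')) ?_
    · exact measurable_from_top.comp (measurable_countIn (hA 0))
    · exact Finset.measurable_sum _ fun i _ => ih _ (hC i)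

lemma measurable_sumDistinct_indicator (k : ℕ) {C : Set (Fin k → Y)} (hC : MeasurableSet C) :
    Measurable (sumDistinct k (C.indicator fun _ => 1)) := by
  refine MeasurableSpace.induction_on_inter
    (C := fun s _ => Measurable (sumDistinct k (s.indicator fun _ => (1 : ℝ))))
    generateFrom_pi.symm isPiSystem_pi ?_ ?_ ?_ ?_ C hC
  · have : sumDistinct k ((∅ : Set (Fin k → Y)).indicator fun _ => (1 : ℝ)) = fun _ => 0 := by
      ext x
      simp [sumDistinct]
    rw [this]
    exact measurable_const
  · rintro _ ⟨A, hA, rfl⟩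
    exact measurable_sumDistinct_pi k A fun i => hA i trivial
  · intro t ht ih
    have : sumDistinct k (tᶜ.indicator fun _ => 1) = fun x =>
        sumDistinct k ((Set.univ.pi fun _ => Set.univ).indicator fun _ => 1) x -
          sumDistinct k (t.indicator fun _ => 1) x := by
      ext x
      simp [sumDistinct, Set.indicator_compl]
    rw [this]
    exact (measurable_sumDistinct_pi k _ fun _ => MeasurableSet.univ).sub ih
  · intro t hd ht ih
    have : ∀ x : Config Y, HasSum (fun n => sumDistinct k ((t n).indicator fun _ => 1) x)
        (sumDistinct k ((⋃ n, t n).indicator fun _ => 1) x) := by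
      intro x
      refine hasSum_sum fun e _ => ?_
      set w : Fin k → Y := fun i => (e i).1
      by_cases hw : w ∈ ⋃ n, t n
      · obtain ⟨n, hn⟩ := Set.mem_iUnion.1 hw
        convert hasSum_single (f := fun n => (t n).indicator (fun _ => (1 : ℝ)) w) n
          fun m hm => Set.indicator_of_notMem (fun h => (hd hm).le_bot ⟨h, hn⟩) _ using 1
        simp [Set.indicator_of_mem hn, Set.indicator_of_mem hw]
      · rw [Set.indicator_of_notMem hw]
        convert hasSum_zero using 2 with n
        exact Set.indicator_of_notMem (fun h => hw (Set.mem_iUnion.2 ⟨n, h⟩)) _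
    refine measurable_of_tendsto_metrizable (fun n => ?_)
      (tendsto_pi_nhds.2 fun x => (this x).tendsto_sum_nat)
    exact Finset.measurable_sum _ fun i _ => ih i

lemma measurable_sumDistinct {k : ℕ} {f : (Fin k → Y) → ℝ} (hf : Measurable f) :
    Measurable (sumDistinct k f) := by
  have hs : ∀ g : SimpleFunc (Fin k → Y) ℝ, Measurable (sumDistinct k g) := by
    intro g
    induction g using SimpleFunc.induction with
    | const c hs =>
      rename_i s
      have : sumDistinct k (SimpleFunc.piecewise s hs (SimpleFunc.const _ c) (SimpleFunc.const _ 0))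
          = fun x => c * sumDistinct k (s.indicator fun _ => 1) x := by
        ext x
        rw [sumDistinct, sumDistinct, Finset.mul_sum]
        refine Finset.sum_congr rfl fun e _ => ?_
        simp [Set.indicator_apply, Set.piecewise]
      rw [this]
      exact (measurable_sumDistinct_indicator k hs).const_mul c
    | add _ hf hg =>
      rename_i f g _
      have : sumDistinct k (f + g : SimpleFunc (Fin k → Y) ℝ) =
          fun x => sumDistinct k f x + sumDistinct k g x := by
        ext x
        simp [sumDistinct, Finset.sum_add_distrib]
      rw [this]
      exact hf.add hg
  refine measurable_of_tendsto_metrizable (fun n => hs (hf.stronglyMeasurable.approx n))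
    (tendsto_pi_nhds.2 fun x => ?_)
  exact tendsto_finsetSum _ fun e _ => hf.stronglyMeasurable.tendsto_approx _

end ConfigMeasurability

/-! ### The finite Poisson process and its multivariate Mecke equation -/

section Mecke

open scoped Classical

variable {Y : Type*} [MeasurableSpace Y] (Λ : Measure Y)

lemma lintegral_poissonLaw {H : Config Y → ℝ≥0∞} (hH : Measurable H) :
    ∫⁻ x, H x ∂poissonLaw Λ = ENNReal.ofReal (Real.exp (-(Λ.real Set.univ))) *
      ∑' n : ℕ, (n.factorial : ℝ≥0∞)⁻¹ * ∫⁻ v, H (ofTuple v) ∂Measure.pi fun _ : Fin n => Λ := by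
  rw [poissonLaw, lintegral_smul_measure, lintegral_sum_measure]
  simp_rw [lintegral_smul_measure, lintegral_map hH (measurable_ofTuple _), smul_eq_mul]

lemma exists_sum_equiv_extending {k m n : ℕ} (hn : k + m = n) (e : Fin k ↪ Fin n) :
    ∃ σ : Fin k ⊕ Fin m ≃ Fin n, ∀ i, σ (.inl i) = e i := by
  subst hn
  obtain ⟨τ, hτ⟩ := Equiv.Perm.exists_extending_pair (Fin.castAdd m : Fin k → Fin (k + m)) e
    (Fin.castAdd_injective k m) e.injective
  exact ⟨finSumFinEquiv.trans τ, fun i => by simpa using hτ i⟩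

variable [IsFiniteMeasure Λ]

/-- The product measure is invariant under permuting coordinates, so those selected by `e` may be
split off from the other `m`. The value does not depend on `e`. -/
lemma lintegral_pi_embedding {k m n : ℕ} (hn : k + m = n) (e : Fin k ↪ Fin n)
    {f : (Fin k → Y) → ℝ≥0∞} (hf : Measurable f) {W : Config Y → ℝ≥0∞} (hW : Measurable W) :
    ∫⁻ v, f (fun i => v (e i)) * W (ofTuple v) ∂Measure.pi (fun _ : Fin n => Λ) =
      ∫⁻ y, f y * ∫⁻ w, W (ofTuple y + ofTuple w) ∂Measure.pi (fun _ : Fin m => Λ)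
        ∂Measure.pi fun _ : Fin k => Λ := by
  obtain ⟨σ, hσ⟩ := exists_sum_equiv_extending hn e
  obtain ⟨T, hT, hT1, hT2⟩ : ∃ T : (Fin k → Y) × (Fin m → Y) → Fin n → Y,
      MeasurePreserving T ((Measure.pi fun _ => Λ).prod (Measure.pi fun _ => Λ))
        (Measure.pi fun _ => Λ) ∧
      (∀ p i, T p (σ (.inl i)) = p.1 i) ∧ ∀ p i, T p (σ (.inr i)) = p.2 i :=
    ⟨_, (measurePreserving_piCongrLeft (fun _ : Fin n => Λ) σ).comp
      (measurePreserving_sumPiEquivProdPi_symm fun _ : Fin k ⊕ Fin m => Λ),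
      fun p i => Equiv.piCongrLeft_sumInl (fun _ => Y) σ p.1 p.2 i,
      fun p i => Equiv.piCongrLeft_sumInr (fun _ => Y) σ p.1 p.2 i⟩
  have hmW : Measurable fun v : Fin n → Y => W (ofTuple v) := hW.comp (measurable_ofTuple n)
  have hmW' : Measurable fun p : (Fin k → Y) × (Fin m → Y) => W (ofTuple p.1 + ofTuple p.2) :=
    hW.comp (measurable_config_add.comp (((measurable_ofTuple k).comp measurable_fst).prodMk
      ((measurable_ofTuple m).comp measurable_snd)))
  have hme : Measurable fun v : Fin n → Y => f fun i => v (e i) := hf.comp (by fun_prop)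
  rw [← hT.lintegral_comp (f := fun v => f (fun i => v (e i)) * W (ofTuple v)) (hme.mul hmW)]
  have h2 : ∀ p : (Fin k → Y) × (Fin m → Y), ofTuple (T p) = ofTuple p.1 + ofTuple p.2 := by
    intro p
    simp only [ofTuple_eq_map]
    rw [← Multiset.map_univ_val_equiv σ, ← Finset.univ_disjSum_univ, Finset.val_disjSum,
      Multiset.map_map, Multiset.map_disjSum]
    simp only [Function.comp_apply, hT1, hT2]
  simp only [← hσ, hT1, h2]
  rw [lintegral_prod (fun p : (Fin k → Y) × (Fin m → Y) => f p.1 * W (ofTuple p.1 + ofTuple p.2))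
    (((hf.comp measurable_fst).mul hmW').aemeasurable)]
  refine lintegral_congr fun y => ?_
  exact lintegral_const_mul (f y) (f := fun w => W (ofTuple y + ofTuple w))
    (hmW'.comp measurable_prodMk_left)

/-- The multivariate Mecke equation for the finite Poisson process. -/
theorem lintegral_sumDistinct_mul_poissonLaw {k : ℕ} {f : (Fin k → Y) → ℝ} (hf : Measurable f)
    (hf0 : ∀ y, 0 ≤ f y) {W : Config Y → ℝ≥0∞} (hW : Measurable W) :
    ∫⁻ x, ENNReal.ofReal (sumDistinct k f x) * W x ∂poissonLaw Λ =
      ∫⁻ y, ENNReal.ofReal (f y) * ∫⁻ x, W (ofTuple y + x) ∂poissonLaw Λ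
        ∂Measure.pi fun _ : Fin k => Λ := by
  have hmW' : ∀ m, Measurable fun p : (Fin k → Y) × (Fin m → Y) => W (ofTuple p.1 + ofTuple p.2) :=
    fun m => hW.comp (measurable_config_add.comp
      (((measurable_ofTuple k).comp measurable_fst).prodMk
        ((measurable_ofTuple m).comp measurable_snd)))
  have hfm : Measurable fun y => ENNReal.ofReal (f y) := hf.ennreal_ofReal
  have hWy : ∀ y : Fin k → Y, Measurable fun x => W (ofTuple y + x) := fun y =>
    hW.comp (measurable_config_add.comp measurable_prodMk_left)
  set J : ℕ → ℝ≥0∞ := fun m => ∫⁻ y, ENNReal.ofReal (f y) *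
    ∫⁻ w, W (ofTuple y + ofTuple w) ∂Measure.pi (fun _ : Fin m => Λ) ∂Measure.pi fun _ : Fin k => Λ
    with hJ
  -- All `n.descFactorial k` embeddings contribute the same integral; there are none when `n < k`.
  have hn : ∀ n : ℕ, ∫⁻ v, ENNReal.ofReal (sumDistinct k f (ofTuple v)) * W (ofTuple v)
      ∂Measure.pi (fun _ : Fin n => Λ) = n.descFactorial k * J (n - k) := by
    intro n
    have h1 : ∀ v : Fin n → Y, ENNReal.ofReal (sumDistinct k f (ofTuple v)) * W (ofTuple v) =
        ∑ e : Fin k ↪ Fin n, ENNReal.ofReal (f fun i => v (e i)) * W (ofTuple v) := by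
      intro v
      rw [sumDistinct_eq_embSum (ofTuple_eq_map v).symm, embSum, ENNReal.ofReal_sum_of_nonneg
        fun _ _ => hf0 _, Finset.sum_mul]
    simp_rw [h1]
    rw [lintegral_finsetSum]
    · rcases le_or_gt k n with hk | hk
      · rw [Finset.sum_congr rfl fun e _ =>
          lintegral_pi_embedding Λ (Nat.add_sub_of_le hk) e hfm hW]
        simp [hJ, Fintype.card_embedding_eq]
      · rw [Nat.descFactorial_of_lt hk]
        have : IsEmpty (Fin k ↪ Fin n) := by
          refine ⟨fun e => ?_⟩
          have := Fintype.card_le_of_embedding e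
          simp at this
          lia
        simp
    · intro e _
      exact (hfm.comp (by fun_prop)).mul (hW.comp (measurable_ofTuple n))
  rw [lintegral_poissonLaw Λ (H := fun x => ENNReal.ofReal (sumDistinct k f x) * W x)
    ((measurable_sumDistinct hf).ennreal_ofReal.mul hW)]
  simp_rw [hn, lintegral_poissonLaw Λ (hWy _)]
  have hR : ∀ y : Fin k → Y, ENNReal.ofReal (f y) * (ENNReal.ofReal (Real.exp (-Λ.real Set.univ)) *
      ∑' n : ℕ, (n.factorial : ℝ≥0∞)⁻¹ *
        ∫⁻ w, W (ofTuple y + ofTuple w) ∂Measure.pi fun _ : Fin n => Λ) =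
      ENNReal.ofReal (Real.exp (-Λ.real Set.univ)) * ∑' n : ℕ, (n.factorial : ℝ≥0∞)⁻¹ *
        (ENNReal.ofReal (f y) *
          ∫⁻ w, W (ofTuple y + ofTuple w) ∂Measure.pi fun _ : Fin n => Λ) := by
    intro y
    rw [mul_left_comm, ← ENNReal.tsum_mul_left]
    simp_rw [mul_left_comm (ENNReal.ofReal (f y))]
  have hmI : ∀ n : ℕ, Measurable fun y : Fin k → Y => ENNReal.ofReal (f y) *
      ∫⁻ w, W (ofTuple y + ofTuple w) ∂Measure.pi fun _ : Fin n => Λ :=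
    fun n => hfm.mul (hmW' n).lintegral_prod_right'
  simp_rw [hR]
  rw [lintegral_const_mul _ (Measurable.tsum fun n => (hmI n).const_mul _),
    lintegral_tsum fun n => ((hmI n).const_mul _).aemeasurable]
  congr 1
  simp_rw [lintegral_const_mul _ (hmI _)]
  -- Substitute `n = m + k`, the terms with `n < k` being zero. The quotient of `(m +
  -- k).descFactorial k` by `(m + k)!` is `1 / m!`, which restores the Poisson weights.
  rw [← (add_left_injective k).tsum_eq]
  · refine tsum_congr fun m => ?_
    have h := Nat.factorial_mul_descFactorial (Nat.le_add_left k m)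
    rw [Nat.add_sub_cancel] at h
    rw [Nat.add_sub_cancel, ← h, ← mul_assoc]
    congr 1
    have h0 : ((m + k).descFactorial k : ℝ≥0∞) ≠ 0 := by
      simp [Nat.descFactorial_eq_zero_iff_lt]
    push_cast
    rw [ENNReal.mul_inv (by simp) (by simp), mul_assoc, ENNReal.inv_mul_cancel h0 (by simp),
      mul_one]
  · intro n hn'
    by_contra hk
    have : n < k := by
      by_contra h
      exact hk ⟨n - k, Nat.sub_add_cancel (not_lt.1 h)⟩
    simp [Nat.descFactorial_of_lt this] at hn'

/-- The exponential moments of a Poisson variable. They bound the Gibbs weight, and `a = 0` gives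
total mass one. -/
lemma lintegral_exp_card_poissonLaw (a : ℝ) :
    ∫⁻ x, ENNReal.ofReal (Real.exp (a * x.card)) ∂poissonLaw Λ =
      ENNReal.ofReal (Real.exp (-Λ.real Set.univ) * Real.exp (Real.exp a * Λ.real Set.univ)) := by
  have hm : Measurable fun x : Config Y => ENNReal.ofReal (Real.exp (a * x.card)) := by
    have h := measurable_card (Y := Y)
    fun_prop
  rw [lintegral_poissonLaw Λ hm, ENNReal.ofReal_mul (Real.exp_nonneg _)]
  congr 1
  have hs := NormedSpace.expSeries_div_hasSum_exp (Real.exp a * Λ.real Set.univ)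
  rw [← Real.exp_eq_exp_ℝ] at hs
  rw [← hs.tsum_eq, ENNReal.ofReal_tsum_of_nonneg (fun n => by positivity) hs.summable]
  refine tsum_congr fun n => ?_
  have hc : ∀ v : Fin n → Y, (ofTuple v).card = n := fun v => by simp [ofTuple]
  simp_rw [hc]
  rw [lintegral_const, Measure.pi_univ]
  simp only [Finset.prod_const, Finset.card_univ, Fintype.card_fin]
  rw [mul_comm a, Real.exp_nat_mul, mul_pow, ENNReal.ofReal_div_of_pos (by positivity),
    ENNReal.ofReal_mul (by positivity), ENNReal.ofReal_pow (p := Λ.real _) (by positivity),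
    ofReal_measureReal, ENNReal.ofReal_natCast, mul_comm, ENNReal.div_eq_inv_mul, mul_comm]

instance : IsProbabilityMeasure (poissonLaw Λ) := by
  refine ⟨?_⟩
  have h := lintegral_exp_card_poissonLaw Λ 0
  rw [← Real.exp_add] at h
  simpa using h

end Mecke

/-! ### Geometry of plates -/

section Geometry

/-- Projection along a compact factor is a closed map. Applied to incidences between points and
plates, this yields the measurability of `meet` and of diameters. -/
lemma isClosed_setOf_exists_mem {X Z : Type*} [TopologicalSpace X] [TopologicalSpace Z] {K : Set X}
    (hK : IsCompact K) {S : Set (X × Z)} (hS : IsClosed S) :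
    IsClosed {z | ∃ x ∈ K, (x, z) ∈ S} := by
  have : CompactSpace K := isCompact_iff_compactSpace.1 hK
  have hc : IsClosed ((fun p : K × Z => ((p.1 : X), p.2)) ⁻¹' S) :=
    hS.preimage (by fun_prop)
  convert isClosedMap_snd_of_compactSpace _ hc using 1
  ext z
  simp

lemma IsCompact.exists_dist_eq_diam {X : Type*} [PseudoMetricSpace X] {C : Set X}
    (hC : IsCompact C) (hne : C.Nonempty) : ∃ x ∈ C, ∃ y ∈ C, dist x y = Metric.diam C := by
  obtain ⟨⟨x, y⟩, ⟨hx, hy⟩, hm⟩ := (hC.prod hC).exists_isMaxOn (hne.prod hne)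
    (f := fun p : X × X => dist p.1 p.2) (by fun_prop)
  refine ⟨x, hx, y, hy, le_antisymm (Metric.dist_le_diam_of_mem hC.isBounded hx hy) ?_⟩
  exact Metric.diam_le_of_forall_dist_le dist_nonneg fun u hu v hv => hm (Set.mk_mem_prod hu hv)

/-- The orthogonal complement of the span of two independent vectors has dimension 3 - 2 = 1. -/
lemma exists_smul_eq_of_inner_eq_zero {φ ψ u v : E3} (h : LinearIndependent ℝ ![φ, ψ])
    (hu : u ≠ 0) (hφu : inner ℝ φ u = 0) (hψu : inner ℝ ψ u = 0) (hφv : inner ℝ φ v = 0)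
    (hψv : inner ℝ ψ v = 0) : ∃ c : ℝ, c • u = v := by
  let W : Submodule ℝ E3 := Submodule.span ℝ (Set.range ![φ, ψ])
  have hW : Module.finrank ℝ W = 2 := by
    simpa using finrank_span_eq_card h
  have hsum := W.finrank_add_finrank_orthogonal
  rw [hW, finrank_euclideanSpace_fin] at hsum
  have hmem : ∀ w : E3, inner ℝ φ w = 0 → inner ℝ ψ w = 0 → w ∈ Wᗮ := by
    intro w h1 h2
    rw [Submodule.mem_orthogonal]
    intro z hz
    induction hz using Submodule.span_induction with
    | mem z hz =>
      obtain ⟨i, rfl⟩ := hz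
      fin_cases i
      exacts [h1, h2]
    | zero => simp
    | add a b _ _ ha hb => rw [inner_add_left, ha, hb, add_zero]
    | smul c a _ ha => rw [inner_smul_left, ha, mul_zero]
  have hW1 : Module.finrank ℝ Wᗮ = 1 := Nat.add_left_cancel (hsum : 2 + _ = 2 + 1)
  obtain ⟨c, hc⟩ := (finrank_eq_one_iff_of_nonzero' (⟨u, hmem u hφu hψu⟩ : Wᗮ)
    (by simpa [Subtype.ext_iff] using hu)).1 hW1 ⟨v, hmem v hφv hψv⟩
  exact ⟨c, congrArg Subtype.val hc⟩

lemma linearIndependent_pair_of_norm_eq_one {φ ψ : E3} (hφ : ‖φ‖ = 1) (hψ : ‖ψ‖ = 1)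
    (h : ψ ≠ φ) (h' : ψ ≠ -φ) : LinearIndependent ℝ ![φ, ψ] := by
  rw [LinearIndependent.pair_iff' (by rintro rfl; simp at hφ)]
  rintro a rfl
  rw [norm_smul, hφ, mul_one, Real.norm_eq_abs] at hψ
  rcases eq_or_eq_neg_of_abs_eq hψ with rfl | rfl
  · simp at h
  · simp at h'

/-- A compact convex set contained in a line has length equal to its diameter. -/
lemma hausdorffMeasure_toReal_eq_diam {C : Set E3} (hC : IsCompact C) (hconv : Convex ℝ C)
    (hline : ∀ x ∈ C, ∀ y ∈ C, ∀ z ∈ C, x ≠ y → ∃ c : ℝ, c • (y - x) = z - x) :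
    (μH[1] C).toReal = Metric.diam C := by
  rcases C.eq_empty_or_nonempty with rfl | hne
  · simp
  obtain ⟨x, hx, y, hy, hxy⟩ := hC.exists_dist_eq_diam hne
  have hmax : ∀ u ∈ C, ∀ v ∈ C, dist u v ≤ dist x y := fun u hu v hv => by
    rw [hxy]
    exact Metric.dist_le_diam_of_mem hC.isBounded hu hv
  -- Any `z` in `C` is `x + c • (y - x)`. As `x`, `y` are at maximal distance, `|c| ≤ 1` and `|c -
  -- 1| ≤ 1`, so `c` lies in `[0, 1]`.
  have hseg : C = segment ℝ x y := by
    refine Set.Subset.antisymm (fun z hz => ?_) (hconv.segment_subset hx hy)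
    by_cases hne : x = y
    · subst hne
      have := hmax z hz x hx
      rw [dist_self] at this
      rw [dist_le_zero.1 this]
      exact left_mem_segment ℝ _ _
    · obtain ⟨c, hc⟩ := hline x hx y hy z hz hne
      have hpos : 0 < dist x y := dist_pos.2 hne
      have h1 := hmax z hz x hx
      have h2 := hmax z hz y hy
      have e1 : dist z x = |c| * dist x y := by
        rw [dist_eq_norm, ← hc, norm_smul, dist_comm, dist_eq_norm, Real.norm_eq_abs]
      have e2 : dist z y = |c - 1| * dist x y := by
        have : z - y = (c - 1) • (y - x) := by
          rw [sub_smul, hc, one_smul]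
          abel
        rw [dist_eq_norm, this, norm_smul, dist_comm, dist_eq_norm, Real.norm_eq_abs]
      have h1' : |c| ≤ 1 := by
        rw [e1] at h1
        exact le_of_mul_le_mul_right (by linarith) hpos
      have h2' : |c - 1| ≤ 1 := by
        rw [e2] at h2
        exact le_of_mul_le_mul_right (by linarith) hpos
      rw [segment_eq_image']
      refine ⟨c, ⟨by linarith [abs_le.1 h2'], (abs_le.1 h1').2⟩, ?_⟩
      simp only [hc]
      abel
  rw [← hxy, hseg, hausdorffMeasure_segment, edist_dist, ENNReal.toReal_ofReal dist_nonneg]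

variable {B : Set E3} {b : ℝ}

lemma isClosed_setOf_mem_plate :
    IsClosed {p : E3 × PlateSpace B b | p.1 ∈ plate p.2} := by
  have h1 : IsClosed {p : E3 × PlateSpace B b | dist p.1 (p.2.1 : E3) ≤ (p.2.2.1 : ℝ)} :=
    isClosed_le (by fun_prop) (by fun_prop)
  have h2 : IsClosed {p : E3 × PlateSpace B b |
      inner ℝ (p.2.2.2 : E3) (p.1 - (p.2.1 : E3)) = 0} :=
    isClosed_eq (by fun_prop) (by fun_prop)
  exact h1.inter h2

lemma plate_subset_closedBall (y : PlateSpace B b) :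
    plate y ⊆ Metric.closedBall (y.1 : E3) (y.2.1 : ℝ) := fun _ hw => hw.1

lemma isCompact_plate (y : PlateSpace B b) : IsCompact (plate y) := by
  refine (isCompact_closedBall (y.1 : E3) (y.2.1 : ℝ)).of_isClosed_subset ?_
    (plate_subset_closedBall y)
  exact isClosed_setOf_mem_plate.preimage (f := fun w => (w, y)) (by fun_prop)

lemma convex_plate (y : PlateSpace B b) : Convex ℝ (plate y) := by
  refine (convex_closedBall (y.1 : E3) (y.2.1 : ℝ)).inter ?_
  intro u hu v hv s t _ _ hst
  have : s • u + t • v - (y.1 : E3) = s • (u - y.1) + t • (v - y.1) := by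
    obtain rfl : t = 1 - s := by linarith
    module
  change inner ℝ (y.2.2 : E3) (u - y.1) = 0 at hu
  change inner ℝ (y.2.2 : E3) (v - y.1) = 0 at hv
  change inner ℝ (y.2.2 : E3) (s • u + t • v - y.1) = 0
  rw [this, inner_add_right, inner_smul_right, inner_smul_right, hu, hv]
  simp

lemma exists_compact_superset_plate (hBb : Bornology.IsBounded B) :
    ∃ K : Set E3, IsCompact K ∧ ∀ y : PlateSpace B b, plate y ⊆ K := by
  obtain ⟨R, hR⟩ := hBb.subset_closedBall (0 : E3)
  refine ⟨Metric.closedBall 0 (R + b), isCompact_closedBall _ _, fun y w hw => ?_⟩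
  have h1 := hR y.1.2
  rw [Metric.mem_closedBall] at h1 ⊢
  have h2 := hw.1
  have h3 := y.2.1.2.2
  linarith [dist_triangle w (y.1 : E3) 0]

instance : OpensMeasurableSpace (PlateSpace B b × PlateSpace B b) := inferInstance

instance : SecondCountableTopology (PlateSpace B b × PlateSpace B b) := inferInstance

lemma measurable_meet (hBb : Bornology.IsBounded B) :
    Measurable fun p : PlateSpace B b × PlateSpace B b × PlateSpace B b =>
      meet p.1 p.2.1 p.2.2 := by
  classical
  obtain ⟨K, hK, hsub⟩ := exists_compact_superset_plate (b := b) hBb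
  refine Measurable.ite (IsClosed.measurableSet ?_) measurable_const measurable_const
  have hS : IsClosed {q : E3 × PlateSpace B b × PlateSpace B b × PlateSpace B b |
      q.1 ∈ plate q.2.1 ∧ q.1 ∈ plate q.2.2.1 ∧ q.1 ∈ plate q.2.2.2} :=
    (isClosed_setOf_mem_plate.preimage (continuous_fst.prodMk (by fun_prop))).inter
      ((isClosed_setOf_mem_plate.preimage (continuous_fst.prodMk (by fun_prop))).inter
        (isClosed_setOf_mem_plate.preimage (continuous_fst.prodMk (by fun_prop))))
  convert isClosed_setOf_exists_mem hK hS using 1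
  ext p
  refine ⟨fun ⟨w, hw⟩ => ⟨w, hsub _ hw.1.1, hw.1.1, hw.1.2, hw.2⟩, fun ⟨w, _, hw⟩ =>
    ⟨w, ⟨hw.1, hw.2.1⟩, hw.2.2⟩⟩

lemma measurable_diam_inter (hBb : Bornology.IsBounded B) :
    Measurable fun p : PlateSpace B b × PlateSpace B b =>
      Metric.diam (plate p.1 ∩ plate p.2) := by
  obtain ⟨K, hK, hsub⟩ := exists_compact_superset_plate (b := b) hBb
  refine measurable_of_Ici fun a => ?_
  -- The empty set has diameter 0. Only for `a > 0` does a diameter of at least `a` provide two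
  -- points of the intersection.
  rcases le_or_gt a 0 with ha | ha
  · convert MeasurableSet.univ using 1
    ext p
    simpa using ha.trans Metric.diam_nonneg
  have hS : IsClosed {q : (E3 × E3) × PlateSpace B b × PlateSpace B b |
      (q.1.1 ∈ plate q.2.1 ∧ q.1.1 ∈ plate q.2.2) ∧
      (q.1.2 ∈ plate q.2.1 ∧ q.1.2 ∈ plate q.2.2) ∧ a ≤ dist q.1.1 q.1.2} := by
    have hd : IsClosed {q : (E3 × E3) × PlateSpace B b × PlateSpace B b | a ≤ dist q.1.1 q.1.2} :=
      isClosed_le (by fun_prop) (by fun_prop)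
    refine IsClosed.inter (IsClosed.inter ?_ ?_) (IsClosed.inter (IsClosed.inter ?_ ?_) hd)
    · exact isClosed_setOf_mem_plate.preimage
        (f := fun q : (E3 × E3) × PlateSpace B b × PlateSpace B b => (q.1.1, q.2.1)) (by fun_prop)
    · exact isClosed_setOf_mem_plate.preimage
        (f := fun q : (E3 × E3) × PlateSpace B b × PlateSpace B b => (q.1.1, q.2.2)) (by fun_prop)
    · exact isClosed_setOf_mem_plate.preimage
        (f := fun q : (E3 × E3) × PlateSpace B b × PlateSpace B b => (q.1.2, q.2.1)) (by fun_prop)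
    · exact isClosed_setOf_mem_plate.preimage
        (f := fun q : (E3 × E3) × PlateSpace B b × PlateSpace B b => (q.1.2, q.2.2)) (by fun_prop)
  convert (isClosed_setOf_exists_mem (hK.prod hK) hS).measurableSet using 1
  ext p
  have hC : IsCompact (plate p.1 ∩ plate p.2) :=
    (isCompact_plate p.1).inter_right (isCompact_plate p.2).isClosed
  constructor
  · intro h
    have h' : a ≤ Metric.diam (plate p.1 ∩ plate p.2) := h
    have hne : (plate p.1 ∩ plate p.2).Nonempty := by
      by_contra hne
      rw [Set.not_nonempty_iff_eq_empty.1 hne, Metric.diam_empty] at h'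
      linarith
    obtain ⟨x, hx, y, hy, hxy⟩ := hC.exists_dist_eq_diam hne
    exact ⟨(x, y), ⟨hsub _ hx.1, hsub _ hy.1⟩, hx, hy, hxy ▸ h'⟩
  · rintro ⟨⟨x, y⟩, -, hx, hy, hxy⟩
    exact hxy.trans (Metric.dist_le_diam_of_mem hC.isBounded hx hy)

/-- Planes with independent normals meet within a line, so the intersection of the plates is a
compact convex piece of it. -/
lemma len_eq_diam {s t : PlateSpace B b} (h : (t.2.2 : E3) ≠ s.2.2) (h' : (t.2.2 : E3) ≠ -s.2.2) :
    len s t = Metric.diam (plate s ∩ plate t) := by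
  refine hausdorffMeasure_toReal_eq_diam
    ((isCompact_plate s).inter_right (isCompact_plate t).isClosed)
    ((convex_plate s).inter (convex_plate t)) fun x hx y hy z hz hxy => ?_
  have hd : ∀ {y : PlateSpace B b} {u v : E3}, u ∈ plate y → v ∈ plate y →
      inner ℝ (y.2.2 : E3) (u - v) = 0 := by
    intro y u v hu hv
    rw [← sub_sub_sub_cancel_right u v (y.1 : E3), inner_sub_right, hu.2, hv.2, sub_zero]
  exact exists_smul_eq_of_inner_eq_zero
    (linearIndependent_pair_of_norm_eq_one s.2.2.2.1 t.2.2.2.1 h h') (sub_ne_zero.2 hxy.symm)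
    (hd hy.1 hx.1) (hd hy.2 hx.2) (hd hz.1 hx.1) (hd hz.2 hx.2)

/-- Two parallel plates either have at most one common point or overlap in a two-dimensional
set. -/
lemma len_eq_zero {s t : PlateSpace B b} (h : (t.2.2 : E3) = s.2.2 ∨ (t.2.2 : E3) = -s.2.2) :
    len s t = 0 := by
  set C := plate s ∩ plate t with hC
  by_cases hsub : C.Subsingleton
  · have := Measure.nullSingletonClass_hausdorff E3 one_pos
    rw [len, ← hC, hsub.measure_zero, ENNReal.toReal_zero]
  obtain ⟨x, hx, y, hy, hxy⟩ := Set.not_subsingleton_iff.1 hsub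
  -- By strict convexity the midpoint of two common points is interior to both balls. A small disc
  -- around it in the common plane, with direction space `W`, then lies in both plates.
  set m : E3 := (1 / 2 : ℝ) • x + (1 / 2 : ℝ) • y with hm
  have hball : ∀ p : PlateSpace B b, x ∈ plate p → y ∈ plate p →
      m ∈ Metric.ball (p.1 : E3) (p.2.1 : ℝ) := by
    intro p hx hy
    rw [← interior_closedBall _ p.2.1.2.1.ne']
    exact strictConvex_closedBall ℝ _ _ hx.1 hy.1 hxy (by norm_num) (by norm_num) (by norm_num)
  have hmC : m ∈ C := ((convex_plate s).inter (convex_plate t)) hx hy (by norm_num) (by norm_num)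
    (by norm_num)
  let W : Submodule ℝ E3 := (ℝ ∙ (s.2.2 : E3))ᗮ
  have hs0 : (s.2.2 : E3) ≠ 0 := by
    intro h0
    have := s.2.2.2.1
    simp [h0] at this
  have hW : Module.finrank ℝ W = 2 := by
    have : Fact (Module.finrank ℝ E3 = 2 + 1) := ⟨by simp⟩
    exact Submodule.finrank_orthogonal_span_singleton hs0
  let g : W → E3 := fun v => m + v
  have hg : Isometry g := by
    refine Isometry.of_dist_eq fun u v => ?_
    simp [g, Subtype.dist_eq]
  let U : Set W := g ⁻¹' (Metric.ball (s.1 : E3) (s.2.1 : ℝ) ∩ Metric.ball (t.1 : E3) (t.2.1 : ℝ))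
  have hU : U ∈ nhds (0 : W) := by
    refine ((Metric.isOpen_ball.inter Metric.isOpen_ball).preimage hg.continuous).mem_nhds ?_
    simpa [g] using ⟨hball s hx.1 hy.1, hball t hx.2 hy.2⟩
  have hUC : g '' U ⊆ C := by
    rintro _ ⟨v, hv, rfl⟩
    have hv0 : inner ℝ (s.2.2 : E3) (v : E3) = 0 :=
      Submodule.mem_orthogonal_singleton_iff_inner_right.1 v.2
    have e : ∀ z : E3, g v - z = (m - z) + v := fun z => by simp only [g]; abel
    refine ⟨⟨(Metric.mem_ball.1 hv.1).le, ?_⟩, ⟨(Metric.mem_ball.1 hv.2).le, ?_⟩⟩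
    · rw [e, inner_add_right, hmC.1.2, hv0, add_zero]
    · rw [e, inner_add_right, hmC.2.2, zero_add]
      rcases h with h | h <;> simp [h, hv0]
  have hdim : (1 : ℝ≥0∞) < dimH C := by
    refine lt_of_lt_of_le ?_ (dimH_mono hUC)
    rw [hg.dimH_image, Real.dimH_of_mem_nhds hU, hW]
    norm_num
  -- Dimension above one makes the length infinite, and `toReal` sends infinity to 0.
  have := hausdorffMeasure_of_lt_dimH (d := 1) (by simpa using hdim)
  rw [len, ← hC]
  simp only [NNReal.coe_one] at this
  rw [this, ENNReal.toReal_top]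

lemma measurable_len (hBb : Bornology.IsBounded B) :
    Measurable fun p : PlateSpace B b × PlateSpace B b => len p.1 p.2 := by
  classical
  have h : (fun p : PlateSpace B b × PlateSpace B b => len p.1 p.2) = fun p =>
      if (p.2.2.2 : E3) = p.1.2.2 ∨ (p.2.2.2 : E3) = -p.1.2.2 then 0
      else Metric.diam (plate p.1 ∩ plate p.2) := by
    ext p
    split_ifs with hp
    · exact len_eq_zero hp
    · rw [not_or] at hp
      exact len_eq_diam hp.1 hp.2
  rw [h]
  refine Measurable.ite (IsClosed.measurableSet ?_) measurable_const (measurable_diam_inter hBb)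
  exact (isClosed_eq (by fun_prop) (by fun_prop)).union (isClosed_eq (by fun_prop) (by fun_prop))

lemma len_nonneg (s t : PlateSpace B b) : 0 ≤ len s t := ENNReal.toReal_nonneg

lemma len_le (s t : PlateSpace B b) : len s t ≤ 2 * b := by
  have hr := s.2.1.2
  by_cases h : (t.2.2 : E3) = s.2.2 ∨ (t.2.2 : E3) = -s.2.2
  · rw [len_eq_zero h]
    linarith [hr.1, hr.2]
  · rw [not_or] at h
    rw [len_eq_diam h.1 h.2]
    calc Metric.diam (plate s ∩ plate t)
        ≤ Metric.diam (Metric.closedBall (s.1 : E3) (s.2.1 : ℝ)) :=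
          Metric.diam_mono (Set.inter_subset_left.trans (plate_subset_closedBall s))
            Metric.isBounded_closedBall
      _ ≤ 2 * s.2.1 := Metric.diam_closedBall hr.1.le
      _ ≤ 2 * b := by linarith [hr.2]

lemma len_comm (s t : PlateSpace B b) : len s t = len t s := by
  rw [len, len, Set.inter_comm]

lemma meet_nonneg (s t u : PlateSpace B b) : 0 ≤ meet s t u := by
  unfold meet
  split_ifs <;> norm_num

lemma meet_le_one (s t u : PlateSpace B b) : meet s t u ≤ 1 := by
  unfold meet
  split_ifs <;> norm_num

lemma meet_sq (s t u : PlateSpace B b) : meet s t u ^ 2 = meet s t u := by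
  unfold meet
  split_ifs <;> norm_num

lemma meet_swap_left (s t u : PlateSpace B b) : meet s t u = meet t s u := by
  rw [meet, meet, Set.inter_comm (plate s)]

lemma meet_swap_right (s t u : PlateSpace B b) : meet s t u = meet s u t := by
  rw [meet, meet, Set.inter_right_comm]

lemma measurable_area : Measurable (area : PlateSpace B b → ℝ) := by
  unfold area
  fun_prop

lemma area_nonneg (y : PlateSpace B b) : 0 ≤ area y := by
  unfold area
  positivity

lemma area_le (y : PlateSpace B b) : area y ≤ Real.pi * b ^ 2 := by
  have h := y.2.1.2
  unfold area
  gcongr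
  exacts [h.1.le, h.2]

end Geometry

/-! ### Moments of the plate process -/

section Moments

variable {B : Set E3} {b : ℝ}

lemma sumDistinct_one_le {Y : Type*} {f : Y → ℝ} {C : ℝ} (hf : ∀ y, f y ≤ C) (x : Config Y) :
    sumDistinct 1 (fun y => f (y 0)) x ≤ C * x.card := by
  classical
  rw [sumDistinct_eq_embSum (map_val_toType x), embSum_one fun z : x.ToType => f z.1]
  refine (Finset.sum_le_sum fun z _ => hf z.1).trans ?_
  simp [mul_comm]

lemma measurable_len_pi {k : ℕ} (hBb : Bornology.IsBounded B) (i j : Fin k) :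
    Measurable fun y : Fin k → PlateSpace B b => len (y i) (y j) := by
  have h : Measurable fun y : Fin k → PlateSpace B b => (y i, y j) := by fun_prop
  simpa only [Function.comp_def] using (measurable_len hBb).comp h

lemma measurable_meet_pi {k : ℕ} (hBb : Bornology.IsBounded B) (i j l : Fin k) :
    Measurable fun y : Fin k → PlateSpace B b => meet (y i) (y j) (y l) := by
  have h : Measurable fun y : Fin k → PlateSpace B b => (y i, y j, y l) := by fun_prop
  simpa only [Function.comp_def] using (measurable_meet hBb).comp h

lemma measurable_area_pi {k : ℕ} (i : Fin k) :
    Measurable fun y : Fin k → PlateSpace B b => area (y i) :=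
  measurable_area.comp (measurable_pi_apply i)

lemma measurable_gibbsWeight (hBb : Bornology.IsBounded B) (ν : Fin 3 → ℝ) :
    Measurable (gibbsWeight ν : Config (PlateSpace B b) → ℝ) := by
  have h1 : Measurable (totalArea : Config (PlateSpace B b) → ℝ) :=
    measurable_sumDistinct (measurable_area_pi 0)
  have h2 : Measurable (totalLength : Config (PlateSpace B b) → ℝ) :=
    (measurable_sumDistinct (measurable_len_pi hBb 0 1)).const_mul _
  have h3 : Measurable (triplePoints : Config (PlateSpace B b) → ℝ) :=
    (measurable_sumDistinct (measurable_meet_pi hBb 0 1 2)).const_mul _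
  have : (gibbsWeight ν : Config (PlateSpace B b) → ℝ) = fun x =>
      Real.exp (ν 0 * totalArea x + ν 1 * totalLength x + ν 2 * triplePoints x) := by
    ext x
    simp [gibbsWeight, plateG, Fin.sum_univ_three]
  rw [this]
  fun_prop

lemma gibbsWeight_pos (ν : Fin 3 → ℝ) (x : Config (PlateSpace B b)) : 0 < gibbsWeight ν x :=
  Real.exp_pos _

/-- The length and triple-point terms, quadratic and cubic in the number of plates, only lower the
exponent by the sign conditions. The area term is linear in that number. -/
lemma gibbsWeight_le {ν : Fin 3 → ℝ} (hν₂ : ν 1 ≤ 0) (hν₃ : ν 2 ≤ 0)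
    (x : Config (PlateSpace B b)) :
    gibbsWeight ν x ≤ Real.exp (|ν 0| * (Real.pi * b ^ 2) * x.card) := by
  have hS : totalArea x ≤ Real.pi * b ^ 2 * x.card := sumDistinct_one_le area_le x
  have hS0 : 0 ≤ totalArea x := sumDistinct_nonneg (fun _ => area_nonneg _) x
  have hL0 : 0 ≤ totalLength x :=
    mul_nonneg (by norm_num) (sumDistinct_nonneg (fun _ => len_nonneg _ _) x)
  have hN0 : 0 ≤ triplePoints x :=
    mul_nonneg (by norm_num) (sumDistinct_nonneg (fun _ => meet_nonneg _ _ _) x)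
  rw [gibbsWeight, Real.exp_le_exp]
  simp only [plateG, Fin.sum_univ_three, Matrix.cons_val_zero, Matrix.cons_val_one,
    Matrix.cons_val]
  have h1 : ν 0 * totalArea x ≤ |ν 0| * (Real.pi * b ^ 2 * x.card) :=
    mul_le_mul (le_abs_self _) hS hS0 (abs_nonneg _)
  have h2 := mul_nonpos_of_nonpos_of_nonneg hν₂ hL0
  have h3 := mul_nonpos_of_nonpos_of_nonneg hν₃ hN0
  linarith

variable (Λ : Measure (PlateSpace B b)) [IsFiniteMeasure Λ]

/-- Each added plate costs at most a factor `exp a`, wherever it is. The uniformity in `y` makes the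
outer integrals finite for bounded kernels. -/
lemma lintegral_gibbsWeight_add_le {ν : Fin 3 → ℝ} (hν₂ : ν 1 ≤ 0) (hν₃ : ν 2 ≤ 0) (k : ℕ) :
    ∃ M : ℝ≥0∞, M ≠ ∞ ∧ ∀ y : Fin k → PlateSpace B b,
      ∫⁻ x, ENNReal.ofReal (gibbsWeight ν (ofTuple y + x)) ∂poissonLaw Λ ≤ M := by
  set a := |ν 0| * (Real.pi * b ^ 2)
  refine ⟨ENNReal.ofReal (Real.exp (a * k)) *
    ∫⁻ x, ENNReal.ofReal (Real.exp (a * x.card)) ∂poissonLaw Λ, ?_, fun y => ?_⟩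
  · rw [lintegral_exp_card_poissonLaw]
    exact ENNReal.mul_ne_top ENNReal.ofReal_ne_top ENNReal.ofReal_ne_top
  · rw [← lintegral_const_mul' _ _ ENNReal.ofReal_ne_top]
    refine lintegral_mono fun x => ?_
    rw [← ENNReal.ofReal_mul (Real.exp_nonneg _), ← Real.exp_add]
    refine ENNReal.ofReal_le_ofReal ((gibbsWeight_le hν₂ hν₃ _).trans (le_of_eq ?_))
    congr 1
    simp [ofTuple, a]
    ring

lemma integrable_gibbsWeight (hBb : Bornology.IsBounded B) {ν : Fin 3 → ℝ} (hν₂ : ν 1 ≤ 0)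
    (hν₃ : ν 2 ≤ 0) :
    Integrable (gibbsWeight ν) (poissonLaw Λ) := by
  obtain ⟨M, hM, h⟩ := lintegral_gibbsWeight_add_le Λ hν₂ hν₃ 0
  have h0 := h Fin.elim0
  simp only [ofTuple, List.ofFn_zero, Multiset.coe_nil, zero_add] at h0
  rw [← lintegral_ofReal_ne_top_iff_integrable (measurable_gibbsWeight hBb ν).aestronglyMeasurable
    (.of_forall fun x => (gibbsWeight_pos ν x).le)]
  exact ne_top_of_le_ne_top hM h0

lemma integral_gibbsWeight_pos (hBb : Bornology.IsBounded B) {ν : Fin 3 → ℝ} (hν₂ : ν 1 ≤ 0)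
    (hν₃ : ν 2 ≤ 0) :
    0 < ∫ x, gibbsWeight ν x ∂poissonLaw Λ := by
  rw [integral_pos_iff_support_of_nonneg (fun x => (gibbsWeight_pos ν x).le)
    (integrable_gibbsWeight Λ hBb hν₂ hν₃)]
  have : Function.support (gibbsWeight ν : Config (PlateSpace B b) → ℝ) = Set.univ := by
    ext x
    simp [(gibbsWeight_pos ν x).ne']
  simp [this]

lemma lintegral_plateLaw (hBb : Bornology.IsBounded B) {ν : Fin 3 → ℝ} (hν₂ : ν 1 ≤ 0)
    (hν₃ : ν 2 ≤ 0)
    {H : Config (PlateSpace B b) → ℝ≥0∞} (hH : Measurable H) :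
    ∫⁻ x, H x ∂plateLaw Λ ν = ENNReal.ofReal (∫ x, gibbsWeight ν x ∂poissonLaw Λ)⁻¹ *
      ∫⁻ x, H x * ENNReal.ofReal (gibbsWeight ν x) ∂poissonLaw Λ := by
  have hw := measurable_gibbsWeight (b := b) hBb ν
  rw [plateLaw, lintegral_withDensity_eq_lintegral_mul _ (by fun_prop) hH,
    ← lintegral_const_mul' _ _ ENNReal.ofReal_ne_top]
  refine lintegral_congr fun x => ?_
  rw [Pi.mul_apply, ENNReal.ofReal_mul
    (inv_nonneg.2 (integral_gibbsWeight_pos Λ hBb hν₂ hν₃).le), mul_assoc,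
    mul_comm (H x)]

lemma isProbabilityMeasure_plateLaw (hBb : Bornology.IsBounded B) {ν : Fin 3 → ℝ} (hν₂ : ν 1 ≤ 0)
    (hν₃ : ν 2 ≤ 0) :
    IsProbabilityMeasure (plateLaw Λ ν) := by
  refine ⟨?_⟩
  have hpos := integral_gibbsWeight_pos Λ hBb hν₂ hν₃
  rw [← lintegral_one, lintegral_plateLaw Λ hBb hν₂ hν₃ measurable_const]
  simp only [one_mul]
  rw [← ofReal_integral_eq_lintegral_ofReal (integrable_gibbsWeight Λ hBb hν₂ hν₃)
    (.of_forall fun x => (gibbsWeight_pos ν x).le), ← ENNReal.ofReal_mul (inv_nonneg.2 hpos.le),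
    inv_mul_cancel₀ hpos.ne', ENNReal.ofReal_one]

/-- The moment formula for `U`-statistics of the plate process with bounded kernel. -/
theorem plateLaw_sumDistinct (hBb : Bornology.IsBounded B) {ν : Fin 3 → ℝ} (hν₂ : ν 1 ≤ 0)
    (hν₃ : ν 2 ≤ 0)
    {k : ℕ} {f : (Fin k → PlateSpace B b) → ℝ} (hf : Measurable f)
    (hf0 : ∀ y, 0 ≤ f y) {C : ℝ} (hfC : ∀ y, f y ≤ C) :
    Integrable (sumDistinct k f) (plateLaw Λ ν) ∧ PlateIntegrable Λ ν f ∧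
      ∫ x, sumDistinct k f x ∂plateLaw Λ ν = plateIntegral Λ ν f := by
  set c := ∫ x, gibbsWeight ν x ∂poissonLaw Λ with hc
  have hcpos : 0 < c := integral_gibbsWeight_pos Λ hBb hν₂ hν₃
  have hw := measurable_gibbsWeight (b := b) hBb ν
  have hadd : Measurable fun p : (Fin k → PlateSpace B b) × Config (PlateSpace B b) =>
      gibbsWeight ν (ofTuple p.1 + p.2) :=
    hw.comp (measurable_config_add.comp (((measurable_ofTuple k).comp measurable_fst).prodMk
      measurable_snd))
  have hE : ∀ (y : Fin k → PlateSpace B b), Measurable (plateE ν y) := by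
    intro y
    have : plateE ν y = fun x => gibbsWeight ν (ofTuple y + x) / gibbsWeight ν x := by
      ext x
      rw [eq_div_iff (gibbsWeight_pos ν x).ne', plateE_mul_gibbsWeight]
    rw [this]
    exact (hadd.comp measurable_prodMk_left).div hw
  have hE0 : ∀ (y : Fin k → PlateSpace B b) x, 0 ≤ plateE ν y x := fun y x => Real.exp_nonneg _
  -- The mean of `plateE ν y` under the plate law, with the density already absorbed into the
  -- shifted weight.
  set u : (Fin k → PlateSpace B b) → ℝ≥0∞ := fun y => ENNReal.ofReal c⁻¹ *
    ∫⁻ x, ENNReal.ofReal (gibbsWeight ν (ofTuple y + x)) ∂poissonLaw Λ with hu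
  have hum : Measurable u := hadd.ennreal_ofReal.lintegral_prod_right'.const_mul _
  have huE : ∀ y, ∫⁻ x, ENNReal.ofReal (plateE ν y x) ∂plateLaw Λ ν = u y := by
    intro y
    rw [lintegral_plateLaw Λ hBb hν₂ hν₃ (hE y).ennreal_ofReal]
    simp_rw [← ENNReal.ofReal_mul (hE0 y _), plateE_mul_gibbsWeight]
    rfl
  obtain ⟨M, hM, huM⟩ : ∃ M : ℝ≥0∞, M ≠ ∞ ∧ ∀ y, u y ≤ M := by
    obtain ⟨M, hM, h⟩ := lintegral_gibbsWeight_add_le Λ hν₂ hν₃ k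
    exact ⟨ENNReal.ofReal c⁻¹ * M, ENNReal.mul_ne_top ENNReal.ofReal_ne_top hM,
      fun y => by simp only [hu]; gcongr; exact h y⟩
  have hutop : ∀ y, u y ≠ ∞ := fun y => ne_top_of_le_ne_top hM (huM y)
  have hEint : ∀ y, Integrable (plateE ν y) (plateLaw Λ ν) := fun y => by
    rw [← lintegral_ofReal_ne_top_iff_integrable (hE y).aestronglyMeasurable
      (.of_forall (hE0 y)), huE]
    exact hutop y
  have hEu : ∀ y, ∫ x, plateE ν y x ∂plateLaw Λ ν = (u y).toReal := fun y => by
    rw [integral_eq_lintegral_of_nonneg_ae (.of_forall (hE0 y)) (hE y).aestronglyMeasurable, huE]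
  have hfi : Integrable (fun y => (u y).toReal * f y) (Measure.pi fun _ => Λ) := by
    refine Integrable.of_bound (hum.ennreal_toReal.mul hf).aestronglyMeasurable (M.toReal * C)
      (.of_forall fun y => ?_)
    rw [Real.norm_of_nonneg (mul_nonneg ENNReal.toReal_nonneg (hf0 y))]
    exact mul_le_mul (ENNReal.toReal_mono hM (huM y)) (hfC y) (hf0 y) ENNReal.toReal_nonneg
  have hS := measurable_sumDistinct hf
  have hS0 : ∀ x, 0 ≤ sumDistinct k f x := sumDistinct_nonneg hf0
  -- The Mecke equation with the Gibbs weight as `W`. Working in `ℝ≥0∞` gives integrability and the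
  -- value together.
  have hmecke : ∫⁻ x, ENNReal.ofReal (sumDistinct k f x) ∂plateLaw Λ ν =
      ∫⁻ y, ENNReal.ofReal ((u y).toReal * f y) ∂Measure.pi fun _ => Λ := by
    rw [lintegral_plateLaw Λ hBb hν₂ hν₃ hS.ennreal_ofReal,
      lintegral_sumDistinct_mul_poissonLaw Λ hf hf0 hw.ennreal_ofReal,
      ← lintegral_const_mul' _ _ ENNReal.ofReal_ne_top]
    refine lintegral_congr fun y => ?_
    rw [ENNReal.ofReal_mul ENNReal.toReal_nonneg, ENNReal.ofReal_toReal (hutop y), hu]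
    ring
  refine ⟨?_, ⟨.of_forall hEint, by simpa only [hEu] using hfi⟩, ?_⟩
  · rw [← lintegral_ofReal_ne_top_iff_integrable hS.aestronglyMeasurable (.of_forall hS0), hmecke]
    exact hfi.lintegral_lt_top.ne
  · simp only [plateIntegral, hEu]
    rw [integral_eq_lintegral_of_nonneg_ae (.of_forall hS0) hS.aestronglyMeasurable, hmecke,
      integral_eq_lintegral_of_nonneg_ae
        (.of_forall fun y => mul_nonneg ENNReal.toReal_nonneg (hf0 y)) hfi.aestronglyMeasurable]

end Moments

/-! ### Finiteness of the intensity and assembly of the moment formulas. -/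

lemma isFiniteMeasure_plateIntensity {B : Set E3} (hB : MeasurableSet B)
    (hBb : Bornology.IsBounded B) {b : ℝ} {ρ : B → ℝ≥0} (hρb : ∃ C : ℝ≥0, ∀ z, ρ z ≤ C)
    (Q : Measure (Set.Ioc (0 : ℝ) b)) [IsProbabilityMeasure Q]
    (V : Measure hemisphere) [IsProbabilityMeasure V] :
    IsFiniteMeasure (plateIntensity ρ Q V) := by
  obtain ⟨C, hC⟩ := hρb
  have hv : ((volume : Measure E3).comap (Subtype.val : B → E3)) Set.univ < ∞ := by
    rw [comap_subtype_coe_apply hB, Set.image_univ, Subtype.range_coe]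
    exact hBb.measure_lt_top
  have : IsFiniteMeasure
      (((volume : Measure E3).comap (Subtype.val : B → E3)).withDensity fun z => (ρ z : ℝ≥0∞)) := by
    refine isFiniteMeasure_withDensity (ne_top_of_le_ne_top ?_
      (lintegral_mono (g := fun _ => (C : ℝ≥0∞)) fun z => ENNReal.coe_le_coe.2 (hC z)))
    rw [lintegral_const]
    exact ENNReal.mul_ne_top ENNReal.coe_ne_top hv.ne
  unfold plateIntensity
  infer_instance

theorem theorem5 (B : Set E3) (hB : MeasurableSet B) (hBb : Bornology.IsBounded B) (b : ℝ)
    (ρ : B → ℝ≥0) (hρ : Measurable ρ) (hρb : ∃ C : ℝ≥0, ∀ z, ρ z ≤ C)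
    (Q : Measure (Set.Ioc (0 : ℝ) b)) [IsProbabilityMeasure Q]
    (V : Measure hemisphere) [IsProbabilityMeasure V]
    (Λ : Measure (PlateSpace B b)) (hΛ : Λ = plateIntensity ρ Q V)
    (ν : Fin 3 → ℝ) (hν₂ : ν 1 ≤ 0) (hν₃ : ν 2 ≤ 0)
    (P : Measure (Config (PlateSpace B b))) (hP : P = plateLaw Λ ν) :
    -- the density is a probability density
    IsProbabilityMeasure P ∧
    -- all moments and integrals below exist
    (Integrable totalArea P ∧ Integrable totalLength P ∧ Integrable triplePoints P ∧
      Integrable (fun x => totalArea x ^ 2) P ∧ Integrable (fun x => totalLength x ^ 2) P ∧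
      Integrable (fun x => triplePoints x ^ 2) P) ∧
    (PlateIntegrable Λ ν (fun y : Fin 1 → _ => area (y 0)) ∧
      PlateIntegrable Λ ν (fun y : Fin 2 → _ => len (y 0) (y 1)) ∧
      PlateIntegrable Λ ν (fun y : Fin 3 → _ => meet (y 0) (y 1) (y 2)) ∧
      PlateIntegrable Λ ν (fun y : Fin 2 → _ => area (y 0) * area (y 1)) ∧
      PlateIntegrable Λ ν (fun y : Fin 1 → _ => area (y 0) ^ 2) ∧
      PlateIntegrable Λ ν (fun y : Fin 4 → _ => len (y 0) (y 1) * len (y 2) (y 3)) ∧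
      PlateIntegrable Λ ν (fun y : Fin 3 → _ => len (y 0) (y 1) * len (y 2) (y 0)) ∧
      PlateIntegrable Λ ν (fun y : Fin 2 → _ => len (y 0) (y 1) ^ 2) ∧
      PlateIntegrable Λ ν
        (fun y : Fin 6 → _ => meet (y 0) (y 1) (y 2) * meet (y 3) (y 4) (y 5)) ∧
      PlateIntegrable Λ ν
        (fun y : Fin 5 → _ => meet (y 0) (y 1) (y 2) * meet (y 3) (y 4) (y 0)) ∧
      PlateIntegrable Λ ν
        (fun y : Fin 4 → _ => meet (y 0) (y 1) (y 2) * meet (y 3) (y 1) (y 0))) ∧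
    -- first moments
    ∫ x, totalArea x ∂P = plateIntegral Λ ν (fun y : Fin 1 → _ => area (y 0)) ∧
    ∫ x, totalLength x ∂P =
      1 / 2 * plateIntegral Λ ν (fun y : Fin 2 → _ => len (y 0) (y 1)) ∧
    ∫ x, triplePoints x ∂P =
      1 / 6 * plateIntegral Λ ν (fun y : Fin 3 → _ => meet (y 0) (y 1) (y 2)) ∧
    -- second moments
    ∫ x, totalArea x ^ 2 ∂P =
      plateIntegral Λ ν (fun y : Fin 2 → _ => area (y 0) * area (y 1)) +
      plateIntegral Λ ν (fun y : Fin 1 → _ => area (y 0) ^ 2) ∧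
    ∫ x, totalLength x ^ 2 ∂P =
      1 / 4 * plateIntegral Λ ν (fun y : Fin 4 → _ => len (y 0) (y 1) * len (y 2) (y 3)) +
      plateIntegral Λ ν (fun y : Fin 3 → _ => len (y 0) (y 1) * len (y 2) (y 0)) +
      1 / 2 * plateIntegral Λ ν (fun y : Fin 2 → _ => len (y 0) (y 1) ^ 2) ∧
    ∫ x, triplePoints x ^ 2 ∂P =
      1 / 36 * plateIntegral Λ ν
        (fun y : Fin 6 → _ => meet (y 0) (y 1) (y 2) * meet (y 3) (y 4) (y 5)) +
      1 / 4 * plateIntegral Λ ν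
        (fun y : Fin 5 → _ => meet (y 0) (y 1) (y 2) * meet (y 3) (y 4) (y 0)) +
      1 / 2 * plateIntegral Λ ν
        (fun y : Fin 4 → _ => meet (y 0) (y 1) (y 2) * meet (y 3) (y 1) (y 0)) +
      1 / 6 * plateIntegral Λ ν (fun y : Fin 3 → _ => meet (y 0) (y 1) (y 2)) := by

  subst hP
  have : IsFiniteMeasure Λ := hΛ ▸ isFiniteMeasure_plateIntensity hB hBb hρb Q V
  have hbd : ∀ {x y C D : ℝ}, 0 ≤ x → x ≤ C → 0 ≤ y → y ≤ D → x * y ≤ C * D :=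
    fun hx hxC hy hyD => mul_le_mul hxC hyD hy (hx.trans hxC)
  obtain ⟨iS, pS, eS⟩ := plateLaw_sumDistinct Λ hBb hν₂ hν₃ (k := 1)
    (measurable_area_pi 0) (fun y => area_nonneg _) (fun y => area_le _)
  obtain ⟨iL, pL, eL⟩ := plateLaw_sumDistinct Λ hBb hν₂ hν₃ (k := 2)
    (measurable_len_pi hBb 0 1) (fun y => len_nonneg _ _) (fun y => len_le _ _)
  obtain ⟨iN, pN, eN⟩ := plateLaw_sumDistinct Λ hBb hν₂ hν₃ (k := 3)
    (measurable_meet_pi hBb 0 1 2) (fun y => meet_nonneg _ _ _) (fun y => meet_le_one _ _ _)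
  obtain ⟨iS2, pS2, eS2⟩ := plateLaw_sumDistinct Λ hBb hν₂ hν₃ (k := 2)
    (f := fun y => area (y 0) * area (y 1))
    ((measurable_area_pi 0).mul (measurable_area_pi 1))
    (fun y => mul_nonneg (area_nonneg _) (area_nonneg _))
    (fun y => hbd (area_nonneg _) (area_le _) (area_nonneg _) (area_le _))
  obtain ⟨iS1, pS1, eS1⟩ := plateLaw_sumDistinct Λ hBb hν₂ hν₃ (k := 1)
    ((measurable_area_pi 0).pow_const 2) (fun y => sq_nonneg _)
    (fun y => pow_le_pow_left₀ (area_nonneg _) (area_le _) 2)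
  obtain ⟨iL4, pL4, eL4⟩ := plateLaw_sumDistinct Λ hBb hν₂ hν₃ (k := 4)
    (f := fun y => len (y 0) (y 1) * len (y 2) (y 3))
    ((measurable_len_pi hBb 0 1).mul (measurable_len_pi hBb 2 3))
    (fun y => mul_nonneg (len_nonneg _ _) (len_nonneg _ _))
    (fun y => hbd (len_nonneg _ _) (len_le _ _) (len_nonneg _ _) (len_le _ _))
  obtain ⟨iL3, pL3, eL3⟩ := plateLaw_sumDistinct Λ hBb hν₂ hν₃ (k := 3)
    (f := fun y => len (y 0) (y 1) * len (y 2) (y 0))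
    ((measurable_len_pi hBb 0 1).mul (measurable_len_pi hBb 2 0))
    (fun y => mul_nonneg (len_nonneg _ _) (len_nonneg _ _))
    (fun y => hbd (len_nonneg _ _) (len_le _ _) (len_nonneg _ _) (len_le _ _))
  obtain ⟨iL2, pL2, eL2⟩ := plateLaw_sumDistinct Λ hBb hν₂ hν₃ (k := 2)
    ((measurable_len_pi hBb 0 1).pow_const 2) (fun y => sq_nonneg _)
    (fun y => pow_le_pow_left₀ (len_nonneg _ _) (len_le _ _) 2)
  obtain ⟨iN6, pN6, eN6⟩ := plateLaw_sumDistinct Λ hBb hν₂ hν₃ (k := 6)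
    (f := fun y => meet (y 0) (y 1) (y 2) * meet (y 3) (y 4) (y 5))
    ((measurable_meet_pi hBb 0 1 2).mul (measurable_meet_pi hBb 3 4 5))
    (fun y => mul_nonneg (meet_nonneg _ _ _) (meet_nonneg _ _ _))
    (fun y => hbd (meet_nonneg _ _ _) (meet_le_one _ _ _) (meet_nonneg _ _ _) (meet_le_one _ _ _))
  obtain ⟨iN5, pN5, eN5⟩ := plateLaw_sumDistinct Λ hBb hν₂ hν₃ (k := 5)
    (f := fun y => meet (y 0) (y 1) (y 2) * meet (y 3) (y 4) (y 0))
    ((measurable_meet_pi hBb 0 1 2).mul (measurable_meet_pi hBb 3 4 0))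
    (fun y => mul_nonneg (meet_nonneg _ _ _) (meet_nonneg _ _ _))
    (fun y => hbd (meet_nonneg _ _ _) (meet_le_one _ _ _) (meet_nonneg _ _ _) (meet_le_one _ _ _))
  obtain ⟨iN4, pN4, eN4⟩ := plateLaw_sumDistinct Λ hBb hν₂ hν₃ (k := 4)
    (f := fun y => meet (y 0) (y 1) (y 2) * meet (y 3) (y 1) (y 0))
    ((measurable_meet_pi hBb 0 1 2).mul (measurable_meet_pi hBb 3 1 0))
    (fun y => mul_nonneg (meet_nonneg _ _ _) (meet_nonneg _ _ _))
    (fun y => hbd (meet_nonneg _ _ _) (meet_le_one _ _ _) (meet_nonneg _ _ _) (meet_le_one _ _ _))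
  have hS : (fun x : Config (PlateSpace B b) => totalArea x ^ 2) = fun x =>
      sumDistinct 2 (fun y => area (y 0) * area (y 1)) x +
        sumDistinct 1 (fun y => area (y 0) ^ 2) x := funext fun x => sumDistinct_sq_one area x
  -- The factor `(1 / 2)²` turns the coefficients 1, 4, 2 into 1/4, 1, 1/2.
  have hL : (fun x : Config (PlateSpace B b) => totalLength x ^ 2) = fun x =>
      1 / 4 * sumDistinct 4 (fun y => len (y 0) (y 1) * len (y 2) (y 3)) x +
      sumDistinct 3 (fun y => len (y 0) (y 1) * len (y 2) (y 0)) x +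
      1 / 2 * sumDistinct 2 (fun y => len (y 0) (y 1) ^ 2) x := by
    ext x
    rw [totalLength, mul_pow, sumDistinct_sq_two len_comm]
    ring
  -- The factor `(1 / 6)²` turns 1, 9, 18, 6 into 1/36, 1/4, 1/2, 1/6. In the last term the square
  -- of the indicator `meet` is `meet` itself.
  have hN : (fun x : Config (PlateSpace B b) => triplePoints x ^ 2) = fun x =>
      1 / 36 * sumDistinct 6 (fun y => meet (y 0) (y 1) (y 2) * meet (y 3) (y 4) (y 5)) x +
      1 / 4 * sumDistinct 5 (fun y => meet (y 0) (y 1) (y 2) * meet (y 3) (y 4) (y 0)) x +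
      1 / 2 * sumDistinct 4 (fun y => meet (y 0) (y 1) (y 2) * meet (y 3) (y 1) (y 0)) x +
      1 / 6 * sumDistinct 3 (fun y => meet (y 0) (y 1) (y 2)) x := by
    ext x
    rw [triplePoints, mul_pow, sumDistinct_sq_three meet_swap_left meet_swap_right]
    simp only [meet_sq]
    ring
  rw [hS, hL, hN]
  refine ⟨isProbabilityMeasure_plateLaw Λ hBb hν₂ hν₃,
    ⟨iS, iL.const_mul _, iN.const_mul _, iS2.add iS1, ((iL4.const_mul _).add iL3).add
      (iL2.const_mul _), (((iN6.const_mul _).add (iN5.const_mul _)).add (iN4.const_mul _)).add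
      (iN.const_mul _)⟩,
    ⟨pS, pL, pN, pS2, pS1, pL4, pL3, pL2, pN6, pN5, pN4⟩, eS, ?_, ?_, ?_, ?_, ?_⟩
  · rw [← eL, ← integral_const_mul]
    rfl
  · rw [← eN, ← integral_const_mul]
    rfl
  · rw [← eS2, ← eS1]
    exact integral_add iS2 iS1
  · rw [← eL4, ← eL3, ← eL2, ← integral_const_mul, ← integral_const_mul,
      ← integral_add (iL4.const_mul _) iL3]
    exact integral_add ((iL4.const_mul _).add iL3) (iL2.const_mul _)
  · rw [← eN6, ← eN5, ← eN4, ← eN]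
    have h6 := iN6.const_mul (1 / 36)
    have h5 := iN5.const_mul (1 / 4)
    have h4 := iN4.const_mul (1 / 2)
    have h := integral_add ((h6.add h5).add h4) (iN.const_mul (1 / 6))
    have h' := integral_add (h6.add h5) h4
    simp only [Pi.add_apply] at h h'
    rw [h, h', integral_add h6 h5]
    simp only [integral_const_mul]
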